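/- Let $(V,E)$ be a finite multigraph (finite sets $V,E$ with source and target maps $s,t:E\to V$) without isolated vertices, write $E^i_j$ for the set of edges from $i$ to $j$, and let $N=\max_{i,j}|E^i_j|$. Assume that $(V,E)$ is uniform, i.e. every non-empty $E^i_j$ has exactly $N$ elements, and fix an edge labelling, so that the edges from $i$ to $j$ are written $(i,j)r$, $1\le r\le |E^i_j|$. **Co-actions on a multigraph.** A compact quantum group (CQG) is a pair $(\mathcal A,\Delta)$ of a non-zero unital $C^*$-algebra and a co-associative unital $*$-homomorphism $\Delta:\mathcal A\to\mathcal A\otimes\mathcal A$ (minimal tensor product) such that $(\mathcal A\otimes1)\Delta(\mathcal A)$ and $(1\otimes\mathcal A)\Delta(\mathcal A)$ span dense subspaces. A co-action of it on $C(X)$, $X$ finite, is a unital $*$-homomorphism $\gamma:C(X)\to C(X)\otimes\mathcal A$ with $(\gamma\otimes\mathrm{id})\gamma=(\mathrm{id}\otimes\Delta)\gamma$ such that $\gamma(C(X))(1\otimes\mathcal A)$ spans a dense subspace. Let $\mathcal C^{Ban}_{(V,E)}$ consist of the triples $(\mathcal A,\Delta,\beta)$, where $(\mathcal A,\Delta)$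 is a CQG and $\beta:L^2(E)\to L^2(E)\otimes\mathcal A$, $\beta(\chi_\tau)=\sum_{\sigma}\chi_\sigma\otimes u^\sigma_\tau$, is a bi-unitary co-representation (both $(u^\sigma_\tau)$ and $(u^{\sigma*}_\tau)$ are unitary matrices, and $\Delta(u^\sigma_\tau)=\sum_{\rho}u^\sigma_\rho\otimes u^\rho_\tau$) with $\beta(\sum_{\tau\in E}\chi_\tau)=(\sum_{\tau\in E}\chi_\tau)\otimes1$, for which there is a co-action $\alpha$ of $(\mathcal A,\Delta)$ on $C(V)$ with $$\beta(f\cdot\xi)=\alpha(f)\beta(\xi),\qquad \beta(\xi\cdot f)=\beta(\xi)\alpha(f)\qquad(f\in C(V),\ \xi\in L^2(E)),$$ where $\chi_i\cdot\chi_\tau=\delta_{i,s(\tau)}\chi_\tau$ and $\chi_\tau\cdot\chi_i=\delta_{i,t(\tau)}\chi_\tau$. Then: * $\mathcal C^{sym}_{(V,E)}$ is the full subcategory of those triples that satisfy restricted orthogonality: $u^{\sigma}_{\tau}u^{\sigma'*}_{\tau}=0=u^{\sigma*}_{\tau}u^{\sigma'}_{\tau}$ for all $\tau\in E$ and all $\sigma\ne\sigma'$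 in $E$ with the same source and the same target; * $\mathcal C^{Bic}_{(V,E)}$ is the full subcategory of those triples for which $\beta$ is moreover a co-action on the algebra $C(E)$ (a quantum permutation of the edges). **The quantum group $Q_{(V,E)}$.** Let $Q_{(V,E)}$ be the universal unital $C^*$-algebra generated by elements $q^{ks}_{ir}$ ($k,i\in V$, $1\le s,r\le N$) such that 1. $(q^{ks}_{ir})_{(ks),(ir)}$ is a quantum permutation matrix: its entries are projections, those in the same row or in the same column are mutually orthogonal, and each row and each column sums to $1$; 2. $\sum_{r}q^{ks}_{ir}=\sum_{r}q^{ks'}_{ir}$ for all $k,i\in V$ and all $s,s'$; 3. $q^{ks}_{ir}q^{ls'}_{jr}=0$ whenever $(i,j)r\in E$ and ($E^k_l=\emptyset$ or $s\neq s'$), with co-product $\Delta(q^{ks}_{ir})=\sum_{k',s'}q^{ks}_{k's'}\otimes q^{k's'}_{ir}$, and let $\beta:L^2(E)\to L^2(E)\otimes Q_{(V,E)}$ be given by $$\beta(\chi_{(i,j)r})=\sum_{(k,l)s\in E}\chi_{(k,l)s}\otimes q^{ks}_{ir}q^{ls}_{jr}.$$ **Statement.** The co-action $\beta$ of $Q_{(V,E)}$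 on $(V,E)$ is of non-Bichon type: the triple $(Q_{(V,E)},\Delta,\beta)$ is an object of $\mathcal C^{sym}_{(V,E)}$, and it is not an object of $\mathcal C^{Bic}_{(V,E)}$ whenever $\mathcal C^{Bic}_{(V,E)}\neq\mathcal C^{sym}_{(V,E)}$. -/

import Mathlib

universe u v

open scoped TensorProduct

noncomputable section

/-- A C⋆-seminorm on a complex ⋆-algebra. -/
structure CStarSeminorm (F : Type u) [Ring F] [Algebra ℂ F] [StarRing F] [StarModule ℂ F] extends
    Seminorm ℂ F where
  mul_le' : ∀ x y, toFun (x * y) ≤ toFun x * toFun y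
  star_mul_self' : ∀ x, toFun (star x * x) = toFun x * toFun x

namespace CStarSeminorm

section Basic

variable {F : Type u} [Ring F] [Algebra ℂ F] [StarRing F] [StarModule ℂ F]

instance : CoeFun (CStarSeminorm F) (fun _ => F → ℝ) := ⟨fun p => p.toSeminorm⟩

theorem mul_le (p : CStarSeminorm F) (x y : F) : p (x * y) ≤ p x * p y := p.mul_le' x y

theorem star_mul_self (p : CStarSeminorm F) (x : F) : p (star x * x) = p x * p x :=
  p.star_mul_self' x

theorem nonneg (p : CStarSeminorm F) (x : F) : 0 ≤ p x := apply_nonneg p.toSeminorm x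

theorem le_star (p : CStarSeminorm F) (x : F) : p x ≤ p (star x) := by
  have h1 := p.star_mul_self x
  have h2 := p.mul_le (star x) x
  have h3 := p.nonneg x
  have h4 := p.nonneg (star x)
  by_contra! h
  nlinarith

theorem apply_star (p : CStarSeminorm F) (x : F) : p (star x) = p x :=
  le_antisymm (by simpa using p.le_star (star x)) (p.le_star x)

/-- The algebra `F` regarded as a seminormed algebra by means of `p`. -/
def Pre (_p : CStarSeminorm F) : Type u := F

variable (p : CStarSeminorm F)

instance : Ring p.Pre := inferInstanceAs (Ring F)
instance : Algebra ℂ p.Pre := inferInstanceAs (Algebra ℂ F)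
instance : StarRing p.Pre := inferInstanceAs (StarRing F)
instance : StarModule ℂ p.Pre := inferInstanceAs (StarModule ℂ F)

instance : SeminormedRing p.Pre :=
  { (inferInstance : Ring p.Pre),
    AddGroupSeminorm.toSeminormedAddCommGroup (E := p.Pre) p.toSeminorm.toAddGroupSeminorm with
    norm_mul_le := p.mul_le }

instance : NormedAlgebra ℂ p.Pre where
  norm_smul_le c x := (map_smul_eq_mul p.toSeminorm c x).le

instance : NormedStarGroup p.Pre where
  norm_star_le x := (p.apply_star x).le

/-- The C⋆-algebra obtained from `F` by dividing out the null space of `p` and completing. -/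
def Compl (p : CStarSeminorm F) : Type u := UniformSpace.Completion p.Pre

instance : NormedRing p.Compl := inferInstanceAs (NormedRing (UniformSpace.Completion p.Pre))
instance : CompleteSpace p.Compl :=
  inferInstanceAs (CompleteSpace (UniformSpace.Completion p.Pre))
instance : Algebra ℂ p.Compl := inferInstanceAs (Algebra ℂ (UniformSpace.Completion p.Pre))
instance : NormedAlgebra ℂ p.Compl where
  norm_smul_le := norm_smul_le (α := ℂ) (β := UniformSpace.Completion p.Pre)

/-- The canonical map from `F` to the completion. -/
def toCompl (x : F) : p.Compl := UniformSpace.Completion.coe' (α := p.Pre) x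

theorem norm_toCompl (x : F) : ‖p.toCompl x‖ = p x :=
  UniformSpace.Completion.norm_coe (E := p.Pre) x

theorem continuous_toCompl : Continuous (fun x : p.Pre => p.toCompl x) :=
  UniformSpace.Completion.continuous_coe p.Pre

theorem denseRange_toCompl : DenseRange (p.toCompl) :=
  UniformSpace.Completion.denseRange_coe (α := p.Pre)

theorem compl_induction {P : p.Compl → Prop} (hc : IsClosed {x | P x})
    (h : ∀ x : F, P (p.toCompl x)) (x : p.Compl) : P x :=
  UniformSpace.Completion.induction_on (α := p.Pre) x hc h

theorem toCompl_add (x y : F) : p.toCompl (x + y) = p.toCompl x + p.toCompl y :=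
  UniformSpace.Completion.coe_add (α := p.Pre) x y
theorem toCompl_mul (x y : F) : p.toCompl (x * y) = p.toCompl x * p.toCompl y :=
  UniformSpace.Completion.coe_mul (α := p.Pre) x y
theorem toCompl_one : p.toCompl 1 = 1 := UniformSpace.Completion.coe_one p.Pre
theorem toCompl_zero : p.toCompl 0 = 0 := UniformSpace.Completion.coe_zero (α := p.Pre)
theorem toCompl_smul (c : ℂ) (x : F) : p.toCompl (c • x) = c • p.toCompl x :=
  UniformSpace.Completion.coe_smul (X := p.Pre) c x

instance : Star p.Compl := ⟨UniformSpace.Completion.map (α := p.Pre) (β := p.Pre) star⟩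

theorem uniformContinuous_pre_star : UniformContinuous (star : p.Pre → p.Pre) :=
  (starNormedAddGroupHom (E := p.Pre)).uniformContinuous

theorem star_toCompl (x : F) : star (p.toCompl x) = p.toCompl (star x) :=
  UniformSpace.Completion.map_coe (α := p.Pre) (β := p.Pre) p.uniformContinuous_pre_star x

theorem continuous_compl_star : Continuous (star : p.Compl → p.Compl) :=
  UniformSpace.Completion.continuous_map (α := p.Pre) (β := p.Pre)

instance : StarRing p.Compl where
  star_involutive x := by
    induction x using p.compl_induction with
    | hc => exact isClosed_eq (p.continuous_compl_star.comp p.continuous_compl_star) continuous_id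
    | h x => rw [star_toCompl, star_toCompl, star_star]
  star_mul x y := by
    induction x using p.compl_induction with
    | hc =>
      exact isClosed_eq (p.continuous_compl_star.comp (continuous_mul_const y))
        (p.continuous_compl_star.const_mul _)
    | h x =>
      induction y using p.compl_induction with
      | hc =>
        exact isClosed_eq (p.continuous_compl_star.comp (continuous_const_mul _))
          (p.continuous_compl_star.mul_const _)
      | h y => simp only [star_toCompl, ← toCompl_mul, star_mul]
  star_add x y := by
    induction x using p.compl_induction with
    | hc =>
      exact isClosed_eq (p.continuous_compl_star.comp (continuous_add_const y))
        (p.continuous_compl_star.add_const _)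
    | h x =>
      induction y using p.compl_induction with
      | hc =>
        exact isClosed_eq (p.continuous_compl_star.comp (continuous_const_add _))
          (p.continuous_compl_star.const_add _)
      | h y => simp only [star_toCompl, ← toCompl_add, star_add]

instance : StarModule ℂ p.Compl where
  star_smul c x := by
    induction x using p.compl_induction with
    | hc =>
      exact isClosed_eq (p.continuous_compl_star.comp (continuous_const_smul c))
        (continuous_const_smul (star c) |>.comp p.continuous_compl_star)
    | h x => simp only [star_toCompl, ← toCompl_smul, star_smul]

instance : CStarRing p.Compl where
  norm_mul_self_le x := by
    induction x using p.compl_induction with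
    | hc =>
      exact isClosed_le (continuous_norm.mul continuous_norm)
        (continuous_norm.comp (p.continuous_compl_star.mul continuous_id))
    | h x =>
      rw [star_toCompl, ← toCompl_mul, norm_toCompl, norm_toCompl, p.star_mul_self]

instance : CStarAlgebra p.Compl where

/-- The canonical ⋆-homomorphism from `F` to the completion. -/
def toComplHom : F →⋆ₐ[ℂ] p.Compl where
  toFun := p.toCompl
  map_one' := p.toCompl_one
  map_mul' := p.toCompl_mul
  map_zero' := p.toCompl_zero
  map_add' := p.toCompl_add
  commutes' c := by
    rw [Algebra.algebraMap_eq_smul_one, toCompl_smul, toCompl_one, Algebra.algebraMap_eq_smul_one]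
  map_star' x := (p.star_toCompl x).symm

theorem toComplHom_apply (x : F) : p.toComplHom x = p.toCompl x := rfl

variable {B : Type v} [CStarAlgebra B]

/-- A ⋆-homomorphism into a C⋆-algebra that is dominated by `p` extends to the completion. -/
def lift (f : F →⋆ₐ[ℂ] B) (hf : ∀ x, ‖f x‖ ≤ p x) : p.Compl →⋆ₐ[ℂ] B := by
  have hc : Continuous (fun x : p.Pre => f x) := by
    have : LipschitzWith 1 (fun x : p.Pre => f x) := by
      refine LipschitzWith.of_dist_le_mul fun x y => ?_
      rw [dist_eq_norm, dist_eq_norm, NNReal.coe_one, one_mul]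
      refine le_trans (le_of_eq ?_) (hf ((x : F) - (y : F)))
      exact congrArg norm (_root_.map_sub f (x : F) (y : F)).symm
    exact this.continuous
  let g : p.Compl →+* B :=
    UniformSpace.Completion.extensionHom (α := p.Pre) (f : F →+* B) hc
  have hg : ∀ x : F, g (p.toCompl x) = f x := fun x =>
    UniformSpace.Completion.extensionHom_coe (α := p.Pre) (f : F →+* B) hc x
  have hgc : Continuous g := UniformSpace.Completion.continuous_extension (α := p.Pre)
  exact
    { g with
      commutes' := fun c => by
        have h := hg (algebraMap ℂ F c)
        rw [AlgHomClass.commutes f c] at h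
        rw [← h, ← toComplHom_apply, AlgHomClass.commutes p.toComplHom c]
        rfl
      map_star' := fun x => by
        change g (star x) = star (g x)
        induction x using p.compl_induction with
        | hc => exact isClosed_eq (hgc.comp p.continuous_compl_star) hgc.star
        | h x => rw [star_toCompl, hg, hg, StarHomClass.map_star] }

theorem lift_toCompl (f : F →⋆ₐ[ℂ] B) (hf : ∀ x, ‖f x‖ ≤ p x) (x : F) :
    p.lift f hf (p.toCompl x) = f x := by
  have hc : Continuous (fun x : p.Pre => f x) := by
    have : LipschitzWith 1 (fun x : p.Pre => f x) := by
      refine LipschitzWith.of_dist_le_mul fun x y => ?_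
      rw [dist_eq_norm, dist_eq_norm, NNReal.coe_one, one_mul]
      refine le_trans (le_of_eq ?_) (hf ((x : F) - (y : F)))
      exact congrArg norm (_root_.map_sub f (x : F) (y : F)).symm
    exact this.continuous
  exact UniformSpace.Completion.extensionHom_coe (α := p.Pre) (f : F →+* B) hc x

/-- The supremum of a pointwise bounded set of C⋆-seminorms. -/
def sSup (S : Set (CStarSeminorm F)) (hS : ∀ x, ∃ C, ∀ p ∈ S, p x ≤ C) : CStarSeminorm F := by
  have hb : ∀ x, BddAbove (Set.range fun p : S => (p : CStarSeminorm F) x) := fun x => by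
    obtain ⟨C, hC⟩ := hS x
    exact ⟨C, by rintro _ ⟨p, rfl⟩; exact hC p p.2⟩
  have h0 : ∀ x, 0 ≤ ⨆ p : S, (p : CStarSeminorm F) x := fun x =>
    Real.iSup_nonneg fun p => (p : CStarSeminorm F).nonneg x
  exact
    { toFun := fun x => ⨆ p : S, (p : CStarSeminorm F) x
      map_zero' := by simp
      add_le' := fun x y => Real.iSup_le (fun p =>
        (map_add_le_add (p : CStarSeminorm F).toSeminorm x y).trans
          (add_le_add (le_ciSup (hb x) p) (le_ciSup (hb y) p))) (add_nonneg (h0 x) (h0 y))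
      neg' := fun x => by
        simp only [map_neg_eq_map]
      smul' := fun c x => by
        simp only [map_smul_eq_mul]
        exact (Real.mul_iSup_of_nonneg (norm_nonneg c) _).symm
      mul_le' := fun x y => Real.iSup_le (fun p =>
        ((p : CStarSeminorm F).mul_le x y).trans
          (mul_le_mul (le_ciSup (hb x) p) (le_ciSup (hb y) p)
            ((p : CStarSeminorm F).nonneg y) (h0 x))) (mul_nonneg (h0 x) (h0 y))
      star_mul_self' := fun x => by
        refine le_antisymm (Real.iSup_le (fun p => ?_) (mul_nonneg (h0 x) (h0 x))) ?_
        · rw [(p : CStarSeminorm F).star_mul_self]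
          exact mul_self_le_mul_self ((p : CStarSeminorm F).nonneg x) (le_ciSup (hb x) p)
        · have h1 : (⨆ p : S, (p : CStarSeminorm F) x) ≤
              Real.sqrt (⨆ p : S, (p : CStarSeminorm F) (star x * x)) := by
            refine Real.iSup_le (fun p => Real.le_sqrt_of_sq_le ?_) (Real.sqrt_nonneg _)
            rw [sq, ← (p : CStarSeminorm F).star_mul_self]
            exact le_ciSup (hb (star x * x)) p
          calc _ ≤ _ := mul_self_le_mul_self (h0 x) h1
            _ = _ := Real.mul_self_sqrt (h0 _) }

theorem sSup_apply (S : Set (CStarSeminorm F)) (hS : ∀ x, ∃ C, ∀ p ∈ S, p x ≤ C) (x : F) :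
    sSup S hS x = ⨆ p : S, (p : CStarSeminorm F) x := rfl

theorem le_sSup (S : Set (CStarSeminorm F)) (hS : ∀ x, ∃ C, ∀ p ∈ S, p x ≤ C)
    {p : CStarSeminorm F} (hp : p ∈ S) (x : F) : p x ≤ sSup S hS x := by
  obtain ⟨C, hC⟩ := hS x
  exact le_ciSup (f := fun p : S => (p : CStarSeminorm F) x)
    ⟨C, by rintro _ ⟨p, rfl⟩; exact hC p p.2⟩ ⟨p, hp⟩

theorem sSup_le (S : Set (CStarSeminorm F)) (hS : ∀ x, ∃ C, ∀ p ∈ S, p x ≤ C)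
    {x : F} {C : ℝ} (h0 : 0 ≤ C) (h : ∀ p ∈ S, p x ≤ C) : sSup S hS x ≤ C :=
  Real.iSup_le (fun p => h p p.2) h0

/-- The C⋆-seminorm `x ↦ ‖f x‖` of a ⋆-homomorphism into a C⋆-algebra. -/
def ofHom (f : F →⋆ₐ[ℂ] B) : CStarSeminorm F where
  toFun x := ‖f x‖
  map_zero' := by simp
  add_le' x y := by simpa using norm_add_le (f x) (f y)
  neg' x := by simp
  smul' c x := by simp [norm_smul]
  mul_le' x y := by simpa using norm_mul_le (f x) (f y)
  star_mul_self' x := by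
    rw [_root_.map_mul, StarHomClass.map_star, CStarRing.norm_star_mul_self]

theorem ofHom_apply (f : F →⋆ₐ[ℂ] B) (x : F) : ofHom f x = ‖f x‖ := rfl

end Basic
section OpSeminorm

variable {F : Type u} [Ring F] [Algebra ℂ F] [StarRing F] [StarModule ℂ F]
  {W : Type v} [NormedAddCommGroup W] [InnerProductSpace ℂ W]

/-- The C⋆-seminorm `x ↦ ‖T x‖` (operator norm) of a ⋆-representation `T` of `F` by bounded
operators on a pre-Hilbert space. -/
def ofRep (T : F →ₗ[ℂ] W →ₗ[ℂ] W) (hmul : ∀ x y ζ, T (x * y) ζ = T x (T y ζ))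
    (hstar : ∀ x ζ θ, inner ℂ (T (star x) ζ) θ = inner ℂ ζ (T x θ))
    (hbdd : ∀ x, ∃ C : ℝ, ∀ ζ, ‖T x ζ‖ ≤ C * ‖ζ‖) : CStarSeminorm F := by
  let R : F → W →L[ℂ] W := fun x => (T x).mkContinuousOfExistsBound (hbdd x)
  have hR : ∀ x ζ, R x ζ = T x ζ := fun _ _ => rfl
  have hmulR : ∀ x y, ‖R (x * y)‖ ≤ ‖R x‖ * ‖R y‖ := fun x y => by
    have : R (x * y) = (R x).comp (R y) := by
      ext1 ζ
      exact hmul x y ζ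
    rw [this]
    exact ContinuousLinearMap.opNorm_comp_le _ _
  have hself : ∀ x, ‖R x‖ * ‖R x‖ ≤ ‖R (star x * x)‖ := fun x => by
    have h : ‖R x‖ ≤ Real.sqrt ‖R (star x * x)‖ := by
      refine ContinuousLinearMap.opNorm_le_bound _ (Real.sqrt_nonneg _) fun ζ => ?_
      refine abs_le_of_sq_le_sq' ?_ (by positivity) |>.2
      rw [mul_pow, Real.sq_sqrt (norm_nonneg _), ← inner_self_eq_norm_sq (𝕜 := ℂ), hR,
        ← hstar, ← hmul]
      refine (RCLike.re_le_norm _).trans ((norm_inner_le_norm _ _).trans ?_)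
      rw [sq, ← mul_assoc]
      exact mul_le_mul_of_nonneg_right ((R (star x * x)).le_opNorm ζ) (norm_nonneg _)
    calc _ ≤ _ := mul_self_le_mul_self (norm_nonneg _) h
      _ = _ := Real.mul_self_sqrt (norm_nonneg _)
  have hle : ∀ x, ‖R x‖ ≤ ‖R (star x)‖ := fun x => by
    have h1 := hself x
    have h2 := hmulR (star x) x
    have h3 := norm_nonneg (R x)
    have h4 := norm_nonneg (R (star x))
    by_contra! h
    nlinarith
  exact
    { toFun := fun x => ‖R x‖
      map_zero' := by
        have : R 0 = 0 := by ext1 ζ; simp [hR]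
        rw [this, norm_zero]
      add_le' := fun x y => by
        have : R (x + y) = R x + R y := by ext1 ζ; simp [hR]
        rw [this]
        exact norm_add_le _ _
      neg' := fun x => by
        have : R (-x) = -R x := by ext1 ζ; simp [hR]
        rw [this, norm_neg]
      smul' := fun c x => by
        have : R (c • x) = c • R x := by ext1 ζ; simp [hR]
        rw [this, norm_smul]
      mul_le' := hmulR
      star_mul_self' := fun x => by
        refine le_antisymm ((hmulR _ _).trans ?_) (hself x)
        have h := hle (star x)
        rw [star_star] at h
        exact mul_le_mul_of_nonneg_right h (norm_nonneg _) }

theorem ofRep_apply (T : F →ₗ[ℂ] W →ₗ[ℂ] W) (hmul : ∀ x y ζ, T (x * y) ζ = T x (T y ζ))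
    (hstar : ∀ x ζ θ, inner ℂ (T (star x) ζ) θ = inner ℂ ζ (T x θ))
    (hbdd : ∀ x, ∃ C : ℝ, ∀ ζ, ‖T x ζ‖ ≤ C * ‖ζ‖) (x : F) :
    ofRep T hmul hstar hbdd x = ‖(T x).mkContinuousOfExistsBound (hbdd x)‖ := rfl

end OpSeminorm

end CStarSeminorm

/-- The tensor product of two ⋆-algebras is a ⋆-algebra, with `(a ⊗ b)⋆ = a⋆ ⊗ b⋆`. -/
instance TensorProduct.instStarRingOfAlgebra {R : Type*} {A : Type*} {B : Type*} [CommRing R]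
    [StarRing R] [Ring A] [Algebra R A] [StarRing A] [StarModule R A] [Ring B] [Algebra R B]
    [StarRing B] [StarModule R B] : StarRing (A ⊗[R] B) where
  star_add := star_add
  star_mul x y := by
    induction x using TensorProduct.induction_on with
    | zero => simp
    | add x x' hx hx' => rw [add_mul, star_add, hx, hx', star_add, mul_add]
    | tmul a b =>
      induction y using TensorProduct.induction_on with
      | zero => simp
      | add y y' hy hy' => rw [mul_add, star_add, hy, hy', star_add, add_mul]
      | tmul c d => simp only [Algebra.TensorProduct.tmul_mul_tmul, TensorProduct.star_tmul, star_mul]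

/-! ### The minimal tensor product of C⋆-algebras -/

namespace MinTensor

section Rep

variable {A B H K : Type u} [CStarAlgebra A] [CStarAlgebra B]
  [NormedAddCommGroup H] [InnerProductSpace ℂ H] [CompleteSpace H]
  [NormedAddCommGroup K] [InnerProductSpace ℂ K] [CompleteSpace K]

/-- The representation `π ⊗ ρ` of the algebraic tensor product `A ⊗ B` on `H ⊗ K`. -/
def repLin (π : A →⋆ₐ[ℂ] (H →L[ℂ] H)) (ρ : B →⋆ₐ[ℂ] (K →L[ℂ] K)) :
    (A ⊗[ℂ] B) →ₗ[ℂ] (H ⊗[ℂ] K →ₗ[ℂ] H ⊗[ℂ] K) :=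
  TensorProduct.lift
    ((TensorProduct.mapBilinear (RingHom.id ℂ) H K H K).compl₁₂
      ((ContinuousLinearMap.coeLM ℂ).comp π.toLinearMap)
      ((ContinuousLinearMap.coeLM ℂ).comp ρ.toLinearMap))

theorem repLin_tmul (π : A →⋆ₐ[ℂ] (H →L[ℂ] H)) (ρ : B →⋆ₐ[ℂ] (K →L[ℂ] K)) (a : A) (b : B)
    (ξ : H) (η : K) : repLin π ρ (a ⊗ₜ b) (ξ ⊗ₜ η) = π a ξ ⊗ₜ[ℂ] ρ b η := rfl

theorem repLin_mul (π : A →⋆ₐ[ℂ] (H →L[ℂ] H)) (ρ : B →⋆ₐ[ℂ] (K →L[ℂ] K)) (x y : A ⊗[ℂ] B)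
    (ζ : H ⊗[ℂ] K) : repLin π ρ (x * y) ζ = repLin π ρ x (repLin π ρ y ζ) := by
  induction x using TensorProduct.induction_on with
  | zero => simp
  | add x x' hx hx' => simp only [add_mul, map_add, LinearMap.add_apply, hx, hx']
  | tmul a b =>
    induction y using TensorProduct.induction_on with
    | zero => simp
    | add y y' hy hy' => simp only [mul_add, map_add, LinearMap.add_apply, hy, hy']
    | tmul c d =>
      induction ζ using TensorProduct.induction_on with
      | zero => simp
      | add ζ ζ' h h' => simp only [map_add, h, h']
      | tmul ξ η =>
        simp only [Algebra.TensorProduct.tmul_mul_tmul, repLin_tmul, map_mul,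
          mul_apply_eq_comp]

theorem inner_repLin_star (π : A →⋆ₐ[ℂ] (H →L[ℂ] H)) (ρ : B →⋆ₐ[ℂ] (K →L[ℂ] K)) (x : A ⊗[ℂ] B)
    (ζ θ : H ⊗[ℂ] K) :
    inner ℂ (repLin π ρ (star x) ζ) θ = inner ℂ ζ (repLin π ρ x θ) := by
  induction x using TensorProduct.induction_on with
  | zero => simp
  | add x x' hx hx' =>
    simp only [star_add, map_add, LinearMap.add_apply, inner_add_left, inner_add_right, hx, hx']
  | tmul a b =>
    induction ζ using TensorProduct.induction_on with
    | zero => simp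
    | add ζ ζ' h h' => simp only [map_add, inner_add_left, h, h']
    | tmul ξ η =>
      induction θ using TensorProduct.induction_on with
      | zero => simp
      | add θ θ' h h' => simp only [map_add, inner_add_right, h, h']
      | tmul ξ' η' =>
        simp only [TensorProduct.star_tmul, repLin_tmul, TensorProduct.inner_tmul, map_star,
          ContinuousLinearMap.star_eq_adjoint, ContinuousLinearMap.adjoint_inner_left]

theorem norm_unitary_apply (π : A →⋆ₐ[ℂ] (H →L[ℂ] H)) {a : A} (ha : a ∈ unitary A) (ξ : H) :
    ‖π a ξ‖ = ‖ξ‖ := by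
  have h : star (π a) * π a = 1 := by
    rw [← map_star, ← map_mul, Unitary.star_mul_self_of_mem ha, map_one]
  have h2 : inner ℂ (π a ξ) (π a ξ) = (inner ℂ ξ ξ : ℂ) := by
    rw [← ContinuousLinearMap.adjoint_inner_left, ← ContinuousLinearMap.star_eq_adjoint,
      ← mul_apply_eq_comp, h, one_apply_eq_self]
  rw [norm_eq_sqrt_re_inner (𝕜 := ℂ), norm_eq_sqrt_re_inner (𝕜 := ℂ), h2]

theorem norm_repLin_unitary (π : A →⋆ₐ[ℂ] (H →L[ℂ] H)) (ρ : B →⋆ₐ[ℂ] (K →L[ℂ] K)) {a : A}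
    (ha : a ∈ unitary A) {b : B} (hb : b ∈ unitary B) (ζ : H ⊗[ℂ] K) :
    ‖repLin π ρ (a ⊗ₜ b) ζ‖ = ‖ζ‖ := by
  let f : H →ₗᵢ[ℂ] H := ⟨(π a : H →ₗ[ℂ] H), norm_unitary_apply π ha⟩
  let g : K →ₗᵢ[ℂ] K := ⟨(ρ b : K →ₗ[ℂ] K), norm_unitary_apply ρ hb⟩
  exact TensorProduct.norm_map f g ζ

end Rep

section Norm

variable {A B : Type u} [CStarAlgebra A] [CStarAlgebra B]

theorem exists_bound (x : A ⊗[ℂ] B) :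
    ∃ C : ℝ, 0 ≤ C ∧ ∀ (H K : Type u) [NormedAddCommGroup H] [InnerProductSpace ℂ H]
      [CompleteSpace H] [NormedAddCommGroup K] [InnerProductSpace ℂ K] [CompleteSpace K]
      (π : A →⋆ₐ[ℂ] (H →L[ℂ] H)) (ρ : B →⋆ₐ[ℂ] (K →L[ℂ] K)) (ζ : H ⊗[ℂ] K),
      ‖repLin π ρ x ζ‖ ≤ C * ‖ζ‖ := by
  have hadd : ∀ x y : A ⊗[ℂ] B,
      (∃ C : ℝ, 0 ≤ C ∧ ∀ (H K : Type u) [NormedAddCommGroup H] [InnerProductSpace ℂ H]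
      [CompleteSpace H] [NormedAddCommGroup K] [InnerProductSpace ℂ K] [CompleteSpace K]
      (π : A →⋆ₐ[ℂ] (H →L[ℂ] H)) (ρ : B →⋆ₐ[ℂ] (K →L[ℂ] K)) (ζ : H ⊗[ℂ] K),
      ‖repLin π ρ x ζ‖ ≤ C * ‖ζ‖) →
      (∃ C : ℝ, 0 ≤ C ∧ ∀ (H K : Type u) [NormedAddCommGroup H] [InnerProductSpace ℂ H]
      [CompleteSpace H] [NormedAddCommGroup K] [InnerProductSpace ℂ K] [CompleteSpace K]
      (π : A →⋆ₐ[ℂ] (H →L[ℂ] H)) (ρ : B →⋆ₐ[ℂ] (K →L[ℂ] K)) (ζ : H ⊗[ℂ] K),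
      ‖repLin π ρ y ζ‖ ≤ C * ‖ζ‖) →
      (∃ C : ℝ, 0 ≤ C ∧ ∀ (H K : Type u) [NormedAddCommGroup H] [InnerProductSpace ℂ H]
      [CompleteSpace H] [NormedAddCommGroup K] [InnerProductSpace ℂ K] [CompleteSpace K]
      (π : A →⋆ₐ[ℂ] (H →L[ℂ] H)) (ρ : B →⋆ₐ[ℂ] (K →L[ℂ] K)) (ζ : H ⊗[ℂ] K),
      ‖repLin π ρ (x + y) ζ‖ ≤ C * ‖ζ‖) := by
    rintro x y ⟨C, hC0, hC⟩ ⟨D, hD0, hD⟩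
    refine ⟨C + D, add_nonneg hC0 hD0, ?_⟩
    intro H K _ _ _ _ _ _ π ρ ζ
    rw [map_add, LinearMap.add_apply, add_mul]
    exact (norm_add_le _ _).trans (add_le_add (hC H K π ρ ζ) (hD H K π ρ ζ))
  have hsmul : ∀ (c : ℂ) (x : A ⊗[ℂ] B),
      (∃ C : ℝ, 0 ≤ C ∧ ∀ (H K : Type u) [NormedAddCommGroup H] [InnerProductSpace ℂ H]
      [CompleteSpace H] [NormedAddCommGroup K] [InnerProductSpace ℂ K] [CompleteSpace K]
      (π : A →⋆ₐ[ℂ] (H →L[ℂ] H)) (ρ : B →⋆ₐ[ℂ] (K →L[ℂ] K)) (ζ : H ⊗[ℂ] K),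
      ‖repLin π ρ x ζ‖ ≤ C * ‖ζ‖) →
      (∃ C : ℝ, 0 ≤ C ∧ ∀ (H K : Type u) [NormedAddCommGroup H] [InnerProductSpace ℂ H]
      [CompleteSpace H] [NormedAddCommGroup K] [InnerProductSpace ℂ K] [CompleteSpace K]
      (π : A →⋆ₐ[ℂ] (H →L[ℂ] H)) (ρ : B →⋆ₐ[ℂ] (K →L[ℂ] K)) (ζ : H ⊗[ℂ] K),
      ‖repLin π ρ (c • x) ζ‖ ≤ C * ‖ζ‖) := by
    rintro c x ⟨C, hC0, hC⟩
    refine ⟨‖c‖ * C, mul_nonneg (norm_nonneg _) hC0, ?_⟩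
    intro H K _ _ _ _ _ _ π ρ ζ
    rw [map_smul, LinearMap.smul_apply, norm_smul, mul_assoc]
    exact mul_le_mul_of_nonneg_left (hC H K π ρ ζ) (norm_nonneg _)
  induction x using TensorProduct.induction_on with
  | zero => exact ⟨0, le_rfl, by intros; simp⟩
  | add x y hx hy => exact hadd x y hx hy
  | tmul a b =>
    have ha : a ∈ Submodule.span ℂ (unitary A : Set A) := by simp [CStarAlgebra.span_unitary]
    have hb : b ∈ Submodule.span ℂ (unitary B : Set B) := by simp [CStarAlgebra.span_unitary]
    induction ha using Submodule.span_induction with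
    | zero => exact ⟨0, le_rfl, by intros; simp⟩
    | add a a' _ _ h h' => rw [TensorProduct.add_tmul]; exact hadd _ _ h h'
    | smul c a _ h => rw [← TensorProduct.smul_tmul']; exact hsmul _ _ h
    | mem a ha =>
      induction hb using Submodule.span_induction with
      | zero => exact ⟨0, le_rfl, by intros; simp⟩
      | add b b' _ _ h h' => rw [TensorProduct.tmul_add]; exact hadd _ _ h h'
      | smul c b _ h => rw [TensorProduct.tmul_smul]; exact hsmul _ _ h
      | mem b hb =>
        refine ⟨1, zero_le_one, ?_⟩
        intro H K _ _ _ _ _ _ π ρ ζ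
        rw [one_mul]
        exact (norm_repLin_unitary π ρ ha hb ζ).le

variable {H K : Type u} [NormedAddCommGroup H] [InnerProductSpace ℂ H] [CompleteSpace H]
  [NormedAddCommGroup K] [InnerProductSpace ℂ K] [CompleteSpace K]

/-- The C⋆-seminorm `x ↦ ‖(π ⊗ ρ)(x)‖` on the algebraic tensor product. -/
def repSeminorm (π : A →⋆ₐ[ℂ] (H →L[ℂ] H)) (ρ : B →⋆ₐ[ℂ] (K →L[ℂ] K)) :
    CStarSeminorm (A ⊗[ℂ] B) :=
  CStarSeminorm.ofRep (repLin π ρ) (repLin_mul π ρ) (inner_repLin_star π ρ)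
    fun x => (exists_bound x).imp fun _ hC ζ => hC.2 H K π ρ ζ

theorem repSeminorm_congr {C D : Type u} [CStarAlgebra C] [CStarAlgebra D]
    (π : A →⋆ₐ[ℂ] (H →L[ℂ] H)) (ρ : B →⋆ₐ[ℂ] (K →L[ℂ] K))
    (σ : C →⋆ₐ[ℂ] (H →L[ℂ] H)) (τ : D →⋆ₐ[ℂ] (K →L[ℂ] K)) (x : A ⊗[ℂ] B) (y : C ⊗[ℂ] D)
    (h : repLin π ρ x = repLin σ τ y) : repSeminorm π ρ x = repSeminorm σ τ y := by
  unfold repSeminorm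
  rw [CStarSeminorm.ofRep_apply, CStarSeminorm.ofRep_apply]
  congr 1
  ext1 ζ
  exact congrArg (fun T => T ζ) h

theorem repSeminorm_le (π : A →⋆ₐ[ℂ] (H →L[ℂ] H)) (ρ : B →⋆ₐ[ℂ] (K →L[ℂ] K)) (x : A ⊗[ℂ] B)
    {C : ℝ} (h0 : 0 ≤ C) (h : ∀ ζ, ‖repLin π ρ x ζ‖ ≤ C * ‖ζ‖) : repSeminorm π ρ x ≤ C :=
  ContinuousLinearMap.opNorm_le_bound _ h0 h

variable (A B) in
/-- The seminorms `x ↦ ‖(π ⊗ ρ)(x)‖`, for all pairs of representations `π` of `A` and `ρ` of `B`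
on Hilbert spaces. -/
def repSeminorms : Set (CStarSeminorm (A ⊗[ℂ] B)) :=
  {p | ∃ (H K : Type u) (_ : NormedAddCommGroup H) (_ : InnerProductSpace ℂ H)
    (_ : CompleteSpace H) (_ : NormedAddCommGroup K) (_ : InnerProductSpace ℂ K)
    (_ : CompleteSpace K) (π : A →⋆ₐ[ℂ] (H →L[ℂ] H)) (ρ : B →⋆ₐ[ℂ] (K →L[ℂ] K)),
    p = repSeminorm π ρ}

theorem repSeminorms_bounded (x : A ⊗[ℂ] B) : ∃ C, ∀ p ∈ repSeminorms A B, p x ≤ C := by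
  obtain ⟨C, hC0, hC⟩ := exists_bound x
  refine ⟨C, ?_⟩
  rintro _ ⟨H, K, _, _, _, _, _, _, π, ρ, rfl⟩
  exact repSeminorm_le π ρ x hC0 fun ζ => hC H K π ρ ζ

variable (A B) in
/-- The minimal (spatial) C⋆-norm on the algebraic tensor product. -/
def minNorm : CStarSeminorm (A ⊗[ℂ] B) :=
  CStarSeminorm.sSup (repSeminorms A B) repSeminorms_bounded

theorem repSeminorm_le_minNorm (π : A →⋆ₐ[ℂ] (H →L[ℂ] H)) (ρ : B →⋆ₐ[ℂ] (K →L[ℂ] K)) (x : A ⊗[ℂ] B) :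
    repSeminorm π ρ x ≤ minNorm A B x :=
  CStarSeminorm.le_sSup _ repSeminorms_bounded
    (p := repSeminorm π ρ) ⟨H, K, _, _, _, _, _, _, π, ρ, rfl⟩ x

end Norm

end MinTensor

/-- The minimal (spatial) tensor product of two unital C⋆-algebras. -/
def MinTensor (A B : Type u) [CStarAlgebra A] [CStarAlgebra B] : Type u :=
  (MinTensor.minNorm A B).Compl

namespace MinTensor

variable {A B C D : Type u} [CStarAlgebra A] [CStarAlgebra B] [CStarAlgebra C] [CStarAlgebra D]

instance : CStarAlgebra (MinTensor A B) := inferInstanceAs (CStarAlgebra (minNorm A B).Compl)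

variable (A B) in
/-- The canonical map from the algebraic to the minimal tensor product. -/
def incl : A ⊗[ℂ] B →⋆ₐ[ℂ] MinTensor A B := (minNorm A B).toComplHom

/-- The elementary tensor `a ⊗ b` in the minimal tensor product. -/
def tmul (a : A) (b : B) : MinTensor A B := incl A B (a ⊗ₜ b)

theorem tmul_mul_tmul (a c : A) (b d : B) :
    tmul a b * tmul c d = tmul (a * c) (b * d) := by
  simp only [tmul, ← map_mul, Algebra.TensorProduct.tmul_mul_tmul]

theorem star_tmul (a : A) (b : B) :
    star (tmul a b) = tmul (star a) (star b) := by
  simp only [tmul, ← map_star, TensorProduct.star_tmul]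

theorem tmul_zero (a : A) :
    tmul a (0 : B) = 0 := by simp [tmul]

theorem zero_tmul (b : B) :
    tmul (0 : A) b = 0 := by simp [tmul]

theorem one_tmul_one :
    tmul (1 : A) (1 : B) = 1 := by
  simp only [tmul, ← Algebra.TensorProduct.one_def, map_one]

theorem tmul_sum {ι : Type*} (s : Finset ι)
    (a : A) (b : ι → B) : tmul a (∑ i ∈ s, b i) = ∑ i ∈ s, tmul a (b i) := by
  simp only [tmul, TensorProduct.tmul_sum, map_sum]

theorem sum_tmul {ι : Type*} (s : Finset ι)
    (a : ι → A) (b : B) : tmul (∑ i ∈ s, a i) b = ∑ i ∈ s, tmul (a i) b := by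
  simp only [tmul, TensorProduct.sum_tmul, map_sum]

/-- The tensor product of two ⋆-homomorphisms on the algebraic tensor product. -/
def algMap (f : A →⋆ₐ[ℂ] C) (g : B →⋆ₐ[ℂ] D) : A ⊗[ℂ] B →⋆ₐ[ℂ] C ⊗[ℂ] D :=
  { Algebra.TensorProduct.map f.toAlgHom g.toAlgHom with
    map_star' := fun x => by
      change Algebra.TensorProduct.map f.toAlgHom g.toAlgHom (star x) =
        star (Algebra.TensorProduct.map f.toAlgHom g.toAlgHom x)
      induction x using TensorProduct.induction_on with
      | zero => simp
      | add x y hx hy => simp only [star_add, map_add, hx, hy]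
      | tmul a b =>
        simp only [TensorProduct.star_tmul, Algebra.TensorProduct.map_tmul]
        congr 1
        · exact map_star f a
        · exact map_star g b }

theorem algMap_tmul (f : A →⋆ₐ[ℂ] C) (g : B →⋆ₐ[ℂ] D) (a : A) (b : B) :
    algMap f g (a ⊗ₜ b) = f a ⊗ₜ g b := rfl

theorem minNorm_algMap_le (f : A →⋆ₐ[ℂ] C) (g : B →⋆ₐ[ℂ] D) (x : A ⊗[ℂ] B) :
    minNorm C D (algMap f g x) ≤ minNorm A B x := by
  refine CStarSeminorm.sSup_le _ _ ((minNorm A B).nonneg x) ?_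
  rintro _ ⟨H, K, _, _, _, _, _, _, π, ρ, rfl⟩
  have h : repLin π ρ (algMap f g x) = repLin (π.comp f) (ρ.comp g) x := by
    induction x using TensorProduct.induction_on with
    | zero => simp
    | add x y hx hy => simp only [map_add, hx, hy]
    | tmul a b => rfl
  exact (repSeminorm_congr _ _ _ _ _ _ h).le.trans (repSeminorm_le_minNorm _ _ x)

/-- The tensor product `f ⊗ g` of two ⋆-homomorphisms on the minimal tensor product. -/
def map (f : A →⋆ₐ[ℂ] C) (g : B →⋆ₐ[ℂ] D) : MinTensor A B →⋆ₐ[ℂ] MinTensor C D :=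
  (minNorm A B).lift ((incl C D).comp (algMap f g)) fun x =>
    ((minNorm C D).norm_toCompl _).le.trans (minNorm_algMap_le f g x)

theorem map_tmul (f : A →⋆ₐ[ℂ] C) (g : B →⋆ₐ[ℂ] D) (a : A) (b : B) :
    map f g (tmul a b) = tmul (f a) (g b) :=
  (minNorm A B).lift_toCompl _ _ _

/-- The canonical identification of `(A ⊗ B) ⊗ C` with `A ⊗ (B ⊗ C)`, as a relation: it is the
closure of the linear relation spanned by the pairs of `(a ⊗ b) ⊗ c` and `a ⊗ (b ⊗ c)`, that is, the
graph of the isometric isomorphism that maps the former to the latter. -/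
def AssocRel (x : MinTensor (MinTensor A B) C) (y : MinTensor A (MinTensor B C)) : Prop :=
  (x, y) ∈ closure (Submodule.span ℂ
    {z : MinTensor (MinTensor A B) C × MinTensor A (MinTensor B C) |
      ∃ (a : A) (b : B) (c : C), z = (tmul (tmul a b) c, tmul a (tmul b c))} : Set _)

end MinTensor

/-! ### Compact quantum groups, co-actions and co-representations -/

section Quantum

variable {A : Type u} [CStarAlgebra A]

/-- `(A, Δ)` is a compact quantum group in the sense of Woronowicz: `Δ` is co-associative, and
`(A ⊗ 1) Δ(A)` and `(1 ⊗ A) Δ(A)` span dense subspaces of `A ⊗ A`. -/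
structure IsCQG (Δ : A →⋆ₐ[ℂ] MinTensor A A) : Prop where
  nontrivial : Nontrivial A
  coassoc : ∀ a, MinTensor.AssocRel (MinTensor.map Δ (StarAlgHom.id ℂ A) (Δ a))
    (MinTensor.map (StarAlgHom.id ℂ A) Δ (Δ a))
  dense_left : closure (Submodule.span ℂ
    {x | ∃ a b : A, x = MinTensor.tmul a 1 * Δ b} : Set (MinTensor A A)) = Set.univ
  dense_right : closure (Submodule.span ℂ
    {x | ∃ a b : A, x = MinTensor.tmul 1 a * Δ b} : Set (MinTensor A A)) = Set.univ

variable {X : Type u} [Fintype X] [DecidableEq X]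

/-- The matrix `(u^x_y)` of a linear map `γ : ℂ^X → ℂ^X ⊗ A`, where `ℂ^X ⊗ A` is written as
`X → A`: it is given by `γ(χ_y) = ∑ x, χ_x ⊗ u^x_y`. -/
def coeffMatrix (γ : (X → ℂ) →ₗ[ℂ] (X → A)) : Matrix X X A :=
  Matrix.of fun x y => γ (Pi.single y 1) x

/-- `(γ ⊗ id) γ = (id ⊗ Δ) γ`. -/
def IsCoassociative (Δ : A →⋆ₐ[ℂ] MinTensor A A) (γ : (X → ℂ) →ₗ[ℂ] (X → A)) : Prop :=
  ∀ (f : X → ℂ) (x : X),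
    ∑ y, MinTensor.tmul (γ (Pi.single y 1) x) (γ f y) = Δ (γ f x)

/-- `γ` is a bi-unitary co-representation of `(A, Δ)` on the Hilbert space `L²(X)`: both its matrix
and the matrix of adjoints of the entries are unitary. -/
structure IsBiunitaryCorep (Δ : A →⋆ₐ[ℂ] MinTensor A A) (γ : (X → ℂ) →ₗ[ℂ] (X → A)) : Prop where
  coassoc : IsCoassociative Δ γ
  isUnitary : coeffMatrix γ ∈ unitary (Matrix X X A)
  conj_isUnitary : (coeffMatrix γ).map star ∈ unitary (Matrix X X A)

/-- `γ` is a co-action of `(A, Δ)` on the C⋆-algebra `C(X)`: a unital ⋆-homomorphism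
`C(X) → C(X) ⊗ A` that is co-associative and such that `γ(C(X)) (1 ⊗ A)` spans a dense subspace. -/
structure IsAlgCoaction (Δ : A →⋆ₐ[ℂ] MinTensor A A) (γ : (X → ℂ) →ₗ[ℂ] (X → A)) : Prop where
  map_one : γ 1 = 1
  map_mul : ∀ f g, γ (f * g) = γ f * γ g
  map_star : ∀ f, γ (star f) = star (γ f)
  coassoc : IsCoassociative Δ γ
  dense : closure (Submodule.span ℂ
    {z : X → A | ∃ (f : X → ℂ) (a : A), z = fun x => γ f x * a} : Set (X → A)) = Set.univ

end Quantum

/-! ### Multigraphs -/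

/-- A multigraph with vertex set `V`, edge set `E`, and no isolated vertex. -/
structure Multigraph (V E : Type u) where
  source : E → V
  target : E → V
  no_isolated : ∀ v, ∃ e, source e = v ∨ target e = v

namespace Multigraph

variable {V E : Type u} [Fintype V] [DecidableEq V] [Fintype E]
  (G : Multigraph V E)

/-- The set of edges from `i` to `j`. -/
def edgesBetween (i j : V) : Finset E := {e | G.source e = i ∧ G.target e = j}

/-- The maximal number `N` of parallel edges. -/
def maxMult : ℕ := Finset.univ.sup fun p : V × V => (G.edgesBetween p.1 p.2).card

/-- Any two non-empty sets of parallel edges have the same size. -/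
def IsUniform : Prop :=
  ∀ i j k l, (G.edgesBetween i j).Nonempty → (G.edgesBetween k l).Nonempty →
    (G.edgesBetween i j).card = (G.edgesBetween k l).card

/-- A labelling of the edges, by which an edge is written as `(i, j)r` with source `i`, target `j`
and label `r`; the edges from `i` to `j` carry each of the first `|E^i_j|` labels once. -/
structure EdgeLabeling where
  label : E → Fin G.maxMult
  bijOn : ∀ i j, Set.BijOn label (G.edgesBetween i j)
    {r | (r : ℕ) < (G.edgesBetween i j).card}

theorem IsUniform.card_eq {G : Multigraph V E} (hG : G.IsUniform) {i j : V}
    (h : (G.edgesBetween i j).Nonempty) : (G.edgesBetween i j).card = G.maxMult := by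
  apply le_antisymm
  · exact Finset.le_sup (f := fun p : V × V => (G.edgesBetween p.1 p.2).card)
      (Finset.mem_univ (i, j))
  · refine Finset.sup_le fun p _ => ?_
    rcases (G.edgesBetween p.1 p.2).eq_empty_or_nonempty with h0 | h0
    · simp [h0]
    · exact (hG _ _ _ _ h0 h).le

theorem EdgeLabeling.exists_edge {G : Multigraph V E} (L : G.EdgeLabeling) (hG : G.IsUniform)
    {i j : V} (h : (G.edgesBetween i j).Nonempty) (r : Fin G.maxMult) :
    ∃ e, G.source e = i ∧ G.target e = j ∧ L.label e = r := by
  obtain ⟨e, he, her⟩ := (L.bijOn i j).surjOn (show r ∈ {r : Fin G.maxMult |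
    (r : ℕ) < (G.edgesBetween i j).card} by rw [hG.card_eq h]; exact r.2)
  have := Finset.mem_filter.1 (Finset.mem_coe.1 he)
  exact ⟨e, this.2.1, this.2.2, her⟩

/-! ### The three kinds of co-actions on a multigraph -/

/-- A C⋆-algebra `A` with a ⋆-homomorphism `Δ : A → A ⊗ A` and a linear map
`β : L²(E) → L²(E) ⊗ A`; the latter space is written as `E → A`. -/
structure CoactionTriple (E : Type u) where
  alg : Type u
  [cstarAlgebra : CStarAlgebra alg]
  comul : alg →⋆ₐ[ℂ] MinTensor alg alg
  edgeMap : (E → ℂ) →ₗ[ℂ] (E → alg)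

attribute [instance] CoactionTriple.cstarAlgebra

section Categories

variable [DecidableEq E] {A : Type u} [CStarAlgebra A]

/-- The pair `(α, β)` respects the `C(V)`-`C(V)` bimodule structures of `L²(E)` and of
`L²(E) ⊗ A`, in which functions on `V` act on the left through the source map and on the right
through the target map. -/
def RespectsBimodule (α : (V → ℂ) →ₗ[ℂ] (V → A)) (β : (E → ℂ) →ₗ[ℂ] (E → A)) : Prop :=
  ∀ (f : V → ℂ) (ξ : E → ℂ),
    (β (fun e => f (G.source e) * ξ e) = fun e => α f (G.source e) * β ξ e) ∧
    (β (fun e => ξ e * f (G.target e)) = fun e => β ξ e * α f (G.target e))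

/-- The triple preserves the quantum symmetry of the multigraph in Banica's sense. -/
structure IsBanica (T : CoactionTriple E) : Prop where
  cqg : IsCQG T.comul
  corep : IsBiunitaryCorep T.comul T.edgeMap
  vertex : ∃ α : (V → ℂ) →ₗ[ℂ] (V → T.alg),
    IsAlgCoaction T.comul α ∧ G.RespectsBimodule α T.edgeMap
  fixes_one : T.edgeMap 1 = 1

/-- Restricted orthogonality, in terms of the matrix `(u^σ_τ)` of the co-representation: for
distinct parallel edges `σ, σ'`, one has `u^σ_τ (u^σ'_τ)⋆ = 0` and `(u^σ_τ)⋆ u^σ'_τ = 0`. -/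
def RestrictedOrthogonality (β : (E → ℂ) →ₗ[ℂ] (E → A)) : Prop :=
  ∀ σ σ' τ : E, σ ≠ σ' → G.source σ = G.source σ' → G.target σ = G.target σ' →
    coeffMatrix β σ τ * star (coeffMatrix β σ' τ) = 0 ∧
    star (coeffMatrix β σ τ) * coeffMatrix β σ' τ = 0

/-- The objects of the category `C^sym`. -/
def catSym : Set (CoactionTriple E) :=
  {T | G.IsBanica T ∧ G.RestrictedOrthogonality T.edgeMap}

/-- The objects of the category `C^Bic`: the co-representation on `L²(E)` is moreover a co-action
on the algebra `C(E)`, that is, a quantum permutation of the edges. -/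
def catBic : Set (CoactionTriple E) :=
  {T | G.IsBanica T ∧ IsAlgCoaction T.comul T.edgeMap}

end Categories

/-! ### The quantum group `Q` -/

section Universal

variable {G} (L : G.EdgeLabeling)

/-- The index set `V × X_N`. -/
abbrev Idx (G : Multigraph V E) : Type u := V × Fin G.maxMult

/-- The defining relations of `Q`, for a family `q (k, s) (i, r) = q^{ks}_{ir}`: the family is a
quantum permutation matrix, the corresponding co-action on `C(V) ⊗ C(X_N)` maps `C(V) ⊗ 1` into
`C(V) ⊗ 1 ⊗ B` (`fibre`), and the induced co-action on `B(L²(V)) ⊗ B(L²(X_N))` maps the span of the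
`e_{ij} ⊗ f_{rr}` with `(i, j)r` an edge into itself tensored with `B` (`edge`, `label`; this is for
uniform multigraphs, where all labels occur between any two connected vertices). -/
structure QRel {B : Type v} [Ring B] [StarRing B] (q : Idx G → Idx G → B) : Prop where
  selfAdjoint : ∀ a b, star (q a b) = q a b
  idem : ∀ a b, q a b * q a b = q a b
  row_orth : ∀ a b b', b ≠ b' → q a b * q a b' = 0
  col_orth : ∀ a a' b, a ≠ a' → q a b * q a' b = 0
  row_sum : ∀ a, ∑ b, q a b = 1
  col_sum : ∀ b, ∑ a, q a b = 1
  fibre : ∀ (k i : V) (s s' : Fin G.maxMult), ∑ r, q (k, s) (i, r) = ∑ r, q (k, s') (i, r)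
  edge : ∀ (τ : E) (k l : V) (s s' : Fin G.maxMult), G.edgesBetween k l = ∅ →
    q (k, s) (G.source τ, L.label τ) * q (l, s') (G.target τ, L.label τ) = 0
  label : ∀ (τ : E) (k l : V) (s s' : Fin G.maxMult), s ≠ s' →
    q (k, s) (G.source τ, L.label τ) * q (l, s') (G.target τ, L.label τ) = 0

/-- The free complex ⋆-algebra on self-adjoint generators `x a b`, for `a, b ∈ V × X_N`. -/
abbrev FreeStar (G : Multigraph V E) : Type u := ℂ ⊗[ℝ] FreeAlgebra ℝ (Idx G × Idx G)

instance (Y : Type u) : StarModule ℝ (FreeAlgebra ℝ Y) where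
  star_smul r x := by
    rw [star_trivial r, Algebra.smul_def, star_mul, FreeAlgebra.star_algebraMap,
      Algebra.smul_def, Algebra.commutes]

instance : StarModule ℂ (FreeStar G) where
  star_smul c x := by
    induction x using TensorProduct.induction_on with
    | zero => simp
    | add x y hx hy => simp only [smul_add, star_add, hx, hy]
    | tmul z y =>
      simp only [TensorProduct.smul_tmul', TensorProduct.star_tmul, star_smul]

/-- The generators of the free ⋆-algebra. -/
def gen (a b : Idx G) : FreeStar G := 1 ⊗ₜ FreeAlgebra.ι ℝ (a, b)

theorem star_gen (a b : Idx G) : star (gen a b) = gen a b := by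
  simp [gen, TensorProduct.star_tmul]

/-- The homomorphism on the free algebra with given images of the generators. -/
def freeLiftAlg {B : Type v} [CStarAlgebra B] (q : Idx G → Idx G → B) : FreeStar G →ₐ[ℂ] B :=
  Algebra.TensorProduct.lift (Algebra.ofId ℂ B)
    (FreeAlgebra.lift ℝ fun p : Idx G × Idx G => q p.1 p.2) fun c _ => Algebra.commutes c _

theorem freeLiftAlg_tmul {B : Type v} [CStarAlgebra B] (q : Idx G → Idx G → B) (c : ℂ)
    (y : FreeAlgebra ℝ (Idx G × Idx G)) : freeLiftAlg q (c ⊗ₜ y) =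
      algebraMap ℂ B c * FreeAlgebra.lift ℝ (fun p : Idx G × Idx G => q p.1 p.2) y := rfl

/-- The ⋆-homomorphism on the free ⋆-algebra with given self-adjoint images of the generators. -/
def freeLift {B : Type v} [CStarAlgebra B] (q : Idx G → Idx G → B)
    (hq : ∀ a b, star (q a b) = q a b) : FreeStar G →⋆ₐ[ℂ] B :=
  { freeLiftAlg q with
    map_star' := fun x => by
      change freeLiftAlg q (star x) = star (freeLiftAlg q x)
      have hf : ∀ y : FreeAlgebra ℝ (Idx G × Idx G),
          FreeAlgebra.lift ℝ (fun p : Idx G × Idx G => q p.1 p.2) (star y) =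
            star (FreeAlgebra.lift ℝ (fun p : Idx G × Idx G => q p.1 p.2) y) := fun y => by
        induction y using FreeAlgebra.induction with
        | grade0 r => simp [Algebra.algebraMap_eq_smul_one]
        | grade1 p => simp [hq]
        | mul x y hx hy => rw [star_mul, map_mul, map_mul, hx, hy, star_mul]
        | add x y hx hy => rw [star_add, map_add, map_add, hx, hy, star_add]
      induction x using TensorProduct.induction_on with
      | zero => simp
      | add x y hx hy => simp only [star_add, map_add, hx, hy]
      | tmul c y =>
        rw [TensorProduct.star_tmul, freeLiftAlg_tmul, freeLiftAlg_tmul, hf, star_mul,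
          ← algebraMap_star_comm]
        exact Algebra.commutes _ _ }

theorem freeLift_gen {B : Type v} [CStarAlgebra B] (q : Idx G → Idx G → B)
    (hq : ∀ a b, star (q a b) = q a b) (a b : Idx G) : freeLift q hq (gen a b) = q a b := by
  change freeLiftAlg q (1 ⊗ₜ FreeAlgebra.ι ℝ (a, b)) = _
  rw [freeLiftAlg_tmul, map_one, one_mul, FreeAlgebra.lift_ι_apply]

/-- Relations that hold in the images of all `φ i` hold in the image of `ψ`, if `ψ` identifies
whatever all the `φ i` identify. -/
theorem QRel.transfer {L : G.EdgeLabeling} {ι : Type*} {B : ι → Type*} {C : Type*}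
    [∀ i, CStarAlgebra (B i)] [CStarAlgebra C] (φ : ∀ i, FreeStar G →⋆ₐ[ℂ] B i)
    (ψ : FreeStar G →⋆ₐ[ℂ] C) (h : ∀ x y, (∀ i, φ i x = φ i y) → ψ x = ψ y)
    (hφ : ∀ i, QRel L fun a b => φ i (gen a b)) : QRel L fun a b => ψ (gen a b) where
  selfAdjoint a b := by
    rw [← map_star]
    exact h _ _ fun i => by rw [map_star]; exact (hφ i).selfAdjoint a b
  idem a b := by
    rw [← map_mul]
    exact h _ _ fun i => by rw [map_mul]; exact (hφ i).idem a b
  row_orth a b b' hb := by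
    rw [← map_mul, ← map_zero ψ]
    exact h _ _ fun i => by rw [map_mul, map_zero]; exact (hφ i).row_orth a b b' hb
  col_orth a a' b ha := by
    rw [← map_mul, ← map_zero ψ]
    exact h _ _ fun i => by rw [map_mul, map_zero]; exact (hφ i).col_orth a a' b ha
  row_sum a := by
    rw [← map_sum, ← map_one ψ]
    exact h _ _ fun i => by rw [map_sum, map_one]; exact (hφ i).row_sum a
  col_sum b := by
    rw [← map_sum, ← map_one ψ]
    exact h _ _ fun i => by rw [map_sum, map_one]; exact (hφ i).col_sum b
  fibre k j s s' := by
    rw [← map_sum, ← map_sum]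
    exact h _ _ fun i => by rw [map_sum, map_sum]; exact (hφ i).fibre k j s s'
  edge τ k l s s' hkl := by
    rw [← map_mul, ← map_zero ψ]
    exact h _ _ fun i => by rw [map_mul, map_zero]; exact (hφ i).edge τ k l s s' hkl
  label τ k l s s' hs := by
    rw [← map_mul, ← map_zero ψ]
    exact h _ _ fun i => by rw [map_mul, map_zero]; exact (hφ i).label τ k l s s' hs

/-- The C⋆-seminorms on the free ⋆-algebra for which the generators satisfy the relations of `Q`
in the completion. -/
def admissible : Set (CStarSeminorm (FreeStar G)) :=
  {p | QRel L fun a b => p.toCompl (gen a b)}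

theorem admissible_bounded (x : FreeStar G) : ∃ C, ∀ p ∈ admissible L, p x ≤ C := by
  have hadd : ∀ x y : FreeStar G, (∃ C, ∀ p ∈ admissible L, p x ≤ C) →
      (∃ C, ∀ p ∈ admissible L, p y ≤ C) → ∃ C, ∀ p ∈ admissible L, p (x + y) ≤ C := by
    rintro x y ⟨C, hC⟩ ⟨D, hD⟩
    exact ⟨C + D, fun p hp => (map_add_le_add p.toSeminorm x y).trans
      (add_le_add (hC p hp) (hD p hp))⟩
  have hmul : ∀ x y : FreeStar G, (∃ C, ∀ p ∈ admissible L, p x ≤ C) →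
      (∃ C, ∀ p ∈ admissible L, p y ≤ C) → ∃ C, ∀ p ∈ admissible L, p (x * y) ≤ C := by
    rintro x y ⟨C, hC⟩ ⟨D, hD⟩
    exact ⟨C * D, fun p hp => (p.mul_le x y).trans
      (mul_le_mul (hC p hp) (hD p hp) (p.nonneg y) ((p.nonneg x).trans (hC p hp)))⟩
  have hone : ∀ p : CStarSeminorm (FreeStar G), p 1 ≤ 1 := fun p => by
    have h := p.star_mul_self 1
    rw [star_one, one_mul] at h
    nlinarith [p.nonneg 1]
  have hscal : ∀ c : ℂ, ∃ C, ∀ p ∈ admissible L, p (c • (1 : FreeStar G)) ≤ C := fun c =>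
    ⟨‖c‖ * 1, fun p _ => (map_smul_eq_mul p.toSeminorm c 1).le.trans
      (mul_le_mul_of_nonneg_left (hone p) (norm_nonneg c))⟩
  induction x using TensorProduct.induction_on with
  | zero => exact ⟨0, fun p _ => (map_zero p.toSeminorm).le⟩
  | add x y hx hy => exact hadd x y hx hy
  | tmul c y =>
    have h : c ⊗ₜ[ℝ] y = (c • (1 : FreeStar G)) * ((1 : ℂ) ⊗ₜ[ℝ] y) := by
      simp [Algebra.TensorProduct.one_def, TensorProduct.smul_tmul']
    rw [h]
    refine hmul _ _ (hscal c) ?_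
    induction y using FreeAlgebra.induction with
    | grade0 r =>
      have h : (1 : ℂ) ⊗ₜ[ℝ] algebraMap ℝ (FreeAlgebra ℝ (Idx G × Idx G)) r =
          (r : ℂ) • (1 : FreeStar G) := by
        rw [Algebra.algebraMap_eq_smul_one, ← TensorProduct.smul_tmul,
          Algebra.TensorProduct.one_def, TensorProduct.smul_tmul']
        simp
      rw [h]
      exact hscal _
    | grade1 z =>
      refine ⟨1, fun p hp => ?_⟩
      change p (gen z.1 z.2) ≤ 1
      have h1 := p.star_mul_self (gen z.1 z.2)
      have h2 := congrArg norm (hp.idem z.1 z.2)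
      rw [← p.toCompl_mul, p.norm_toCompl, p.norm_toCompl] at h2
      rw [star_gen, h2] at h1
      nlinarith [p.nonneg (gen z.1 z.2)]
    | mul x y hx hy =>
      have h : (1 : ℂ) ⊗ₜ[ℝ] (x * y) = ((1 : ℂ) ⊗ₜ[ℝ] x) * ((1 : ℂ) ⊗ₜ[ℝ] y) := by simp
      rw [h]
      exact hmul _ _ (hx (by simp [Algebra.TensorProduct.one_def, TensorProduct.smul_tmul']))
        (hy (by simp [Algebra.TensorProduct.one_def, TensorProduct.smul_tmul']))
    | add x y hx hy =>
      rw [TensorProduct.tmul_add]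
      exact hadd _ _ (hx (by simp [Algebra.TensorProduct.one_def, TensorProduct.smul_tmul']))
        (hy (by simp [Algebra.TensorProduct.one_def, TensorProduct.smul_tmul']))

/-- The universal C⋆-seminorm: the largest one for which the relations hold. -/
def univNorm : CStarSeminorm (FreeStar G) :=
  CStarSeminorm.sSup (admissible L) (admissible_bounded L)

/-- The universal C⋆-algebra generated by elements `q^{ks}_{ir}` subject to the relations. -/
def Q : Type u := (univNorm L).Compl

instance : CStarAlgebra (Q L) := inferInstanceAs (CStarAlgebra (univNorm L).Compl)

/-- The canonical generators `Q.q L (k, s) (i, r) = q^{ks}_{ir}`. -/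
def Q.q (a b : Idx G) : Q L := (univNorm L).toCompl (gen a b)

theorem Q.hom_eq (x y : FreeStar G)
    (h : ∀ p ∈ admissible L, CStarSeminorm.toComplHom p x = p.toComplHom y) :
    (univNorm L).toComplHom x = (univNorm L).toComplHom y := by
  rw [← sub_eq_zero, ← map_sub, ← norm_eq_zero, CStarSeminorm.toComplHom_apply,
    CStarSeminorm.norm_toCompl]
  refine le_antisymm (CStarSeminorm.sSup_le _ _ le_rfl fun p hp => ?_) ((univNorm L).nonneg _)
  rw [← p.norm_toCompl, ← CStarSeminorm.toComplHom_apply, map_sub, h p hp, sub_self, norm_zero]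

theorem Q.rel : QRel L (Q.q L) :=
  QRel.transfer (ι := admissible L) (fun p => (p : CStarSeminorm (FreeStar G)).toComplHom)
    (univNorm L).toComplHom (fun x y h => Q.hom_eq L x y fun p hp => h ⟨p, hp⟩) fun p => p.2

/-- The universal property of `Q`: a family in a C⋆-algebra that satisfies the relations is the
image of the canonical generators under a ⋆-homomorphism. -/
def Q.lift {B : Type v} [CStarAlgebra B] {q : Idx G → Idx G → B} (hq : QRel L q) :
    Q L →⋆ₐ[ℂ] B :=
  (univNorm L).lift (freeLift q hq.selfAdjoint) fun x => by
    have hmem : CStarSeminorm.ofHom (freeLift q hq.selfAdjoint) ∈ admissible L := by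
      refine QRel.transfer (ι := Unit) (fun _ => freeLift q hq.selfAdjoint)
        (CStarSeminorm.ofHom (freeLift q hq.selfAdjoint)).toComplHom (fun x y h => ?_) fun _ => ?_
      · rw [← sub_eq_zero, ← map_sub, ← norm_eq_zero, CStarSeminorm.toComplHom_apply,
          CStarSeminorm.norm_toCompl, CStarSeminorm.ofHom_apply, map_sub, h (), sub_self, norm_zero]
      · simpa only [freeLift_gen] using hq
    exact CStarSeminorm.le_sSup _ (admissible_bounded L) hmem x

theorem Q.lift_q {B : Type v} [CStarAlgebra B] {q : Idx G → Idx G → B} (hq : QRel L q)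
    (a b : Idx G) : Q.lift L hq (Q.q L a b) = q a b :=
  ((univNorm L).lift_toCompl _ _ _).trans (freeLift_gen q hq.selfAdjoint a b)

theorem QRel.comul {L : G.EdgeLabeling} (hG : G.IsUniform) {A : Type u} [CStarAlgebra A]
    {q : Idx G → Idx G → A} (hq : QRel L q) :
    QRel L fun a b => ∑ c, MinTensor.tmul (q a c) (q c b) where
  selfAdjoint a b := by simp only [star_sum, MinTensor.star_tmul, hq.selfAdjoint]
  idem a b := by
    rw [Finset.sum_mul_sum]
    refine Finset.sum_congr rfl fun c _ => ?_
    rw [Finset.sum_eq_single c]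
    · rw [MinTensor.tmul_mul_tmul, hq.idem, hq.idem]
    · intro d _ hd
      rw [MinTensor.tmul_mul_tmul, hq.row_orth _ _ _ hd.symm, MinTensor.zero_tmul]
    · simp
  row_orth a b b' h := by
    rw [Finset.sum_mul_sum]
    refine Finset.sum_eq_zero fun c _ => Finset.sum_eq_zero fun d _ => ?_
    rw [MinTensor.tmul_mul_tmul]
    by_cases hd : c = d
    · subst hd; rw [hq.row_orth _ _ _ h, MinTensor.tmul_zero]
    · rw [hq.row_orth _ _ _ hd, MinTensor.zero_tmul]
  col_orth a a' b h := by
    rw [Finset.sum_mul_sum]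
    refine Finset.sum_eq_zero fun c _ => Finset.sum_eq_zero fun d _ => ?_
    rw [MinTensor.tmul_mul_tmul]
    by_cases hd : c = d
    · subst hd; rw [hq.col_orth _ _ _ h, MinTensor.zero_tmul]
    · rw [hq.col_orth _ _ _ hd, MinTensor.tmul_zero]
  row_sum a := by
    rw [Finset.sum_comm]
    simp only [← MinTensor.tmul_sum, hq.row_sum, ← MinTensor.sum_tmul, MinTensor.one_tmul_one]
  col_sum b := by
    rw [Finset.sum_comm]
    simp only [← MinTensor.sum_tmul, hq.col_sum, ← MinTensor.tmul_sum, MinTensor.one_tmul_one]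
  fibre k i s s' := by
    have key : ∀ s, ∑ r, ∑ c, MinTensor.tmul (q (k, s) c) (q c (i, r)) =
        ∑ k', MinTensor.tmul (∑ s'', q (k, s) (k', s'')) (∑ r, q (k', s) (i, r)) := fun s => by
      rw [Finset.sum_comm]
      simp only [← MinTensor.tmul_sum]
      rw [Fintype.sum_prod_type]
      refine Finset.sum_congr rfl fun k' _ => ?_
      rw [MinTensor.sum_tmul]
      exact Finset.sum_congr rfl fun s'' _ => by rw [hq.fibre k' i s'' s]
    rw [key, key]
    exact Finset.sum_congr rfl fun k' _ => by rw [hq.fibre k k' s s', hq.fibre k' i s s']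
  edge τ k l s s' h := by
    rw [Finset.sum_mul_sum]
    refine Finset.sum_eq_zero fun c _ => Finset.sum_eq_zero fun d _ => ?_
    rw [MinTensor.tmul_mul_tmul]
    obtain ⟨k', r⟩ := c
    obtain ⟨l', r'⟩ := d
    rcases (G.edgesBetween k' l').eq_empty_or_nonempty with h0 | h0
    · rw [hq.edge τ k' l' r r' h0, MinTensor.tmul_zero]
    · by_cases hr : r = r'
      · subst hr
        obtain ⟨e, rfl, rfl, rfl⟩ := L.exists_edge hG h0 r
        rw [hq.edge e k l s s' h, MinTensor.zero_tmul]
      · rw [hq.label τ k' l' r r' hr, MinTensor.tmul_zero]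
  label τ k l s s' h := by
    rw [Finset.sum_mul_sum]
    refine Finset.sum_eq_zero fun c _ => Finset.sum_eq_zero fun d _ => ?_
    rw [MinTensor.tmul_mul_tmul]
    obtain ⟨k', r⟩ := c
    obtain ⟨l', r'⟩ := d
    rcases (G.edgesBetween k' l').eq_empty_or_nonempty with h0 | h0
    · rw [hq.edge τ k' l' r r' h0, MinTensor.tmul_zero]
    · by_cases hr : r = r'
      · subst hr
        obtain ⟨e, rfl, rfl, rfl⟩ := L.exists_edge hG h0 r
        rw [hq.label e k l s s' h, MinTensor.zero_tmul]
      · rw [hq.label τ k' l' r r' hr, MinTensor.tmul_zero]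

/-- The co-product of `Q`, with `Δ(q^{ks}_{ir}) = ∑ q^{ks}_{k's'} ⊗ q^{k's'}_{ir}`. -/
def Q.comul (hG : G.IsUniform) : Q L →⋆ₐ[ℂ] MinTensor (Q L) (Q L) :=
  Q.lift L (QRel.comul hG (Q.rel L))

theorem Q.comul_q (hG : G.IsUniform) (a b : Idx G) :
    Q.comul L hG (Q.q L a b) = ∑ c, MinTensor.tmul (Q.q L a c) (Q.q L c b) :=
  Q.lift_q L _ a b

/-- The pair `(source, label)` of an edge. -/
def EdgeLabeling.srcIdx (τ : E) : Idx G := (G.source τ, L.label τ)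

/-- The pair `(target, label)` of an edge. -/
def EdgeLabeling.tgtIdx (τ : E) : Idx G := (G.target τ, L.label τ)

/-- The map `β : L²(E) → L²(E) ⊗ Q`, with
`β(χ_{(i,j)r}) = ∑ χ_{(k,l)s} ⊗ q^{ks}_{ir} q^{ls}_{jr}`, the sum over all edges `(k,l)s`. -/
def Q.edgeMap : (E → ℂ) →ₗ[ℂ] (E → Q L) where
  toFun f σ := ∑ τ, f τ • (Q.q L (L.srcIdx σ) (L.srcIdx τ) * Q.q L (L.tgtIdx σ) (L.tgtIdx τ))
  map_add' f g := by
    funext σ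
    simp only [Pi.add_apply, add_smul, Finset.sum_add_distrib]
  map_smul' c f := by
    funext σ
    simp only [Pi.smul_apply, smul_eq_mul, mul_smul, Finset.smul_sum, RingHom.id_apply]

/-- The triple `(Q, Δ, β)`. -/
def Q.triple (hG : G.IsUniform) : CoactionTriple E where
  alg := Q L
  comul := Q.comul L hG
  edgeMap := Q.edgeMap L

end Universal
end Multigraph
end

/-!
Two arguments carry the proof: one shows that `Q` acts in the restrictedly orthogonal sense, the other
compares `Q` with an arbitrary object of `C^sym`.

Write `q^c_a` for the generators of `Q`, with `a, c ∈ V × X_N`, and regard an edge as the pair of its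
(source, label) and (target, label). By the relations, `q^c_a q^d_b = 0` if `(a, b)` is an edge and
`(c, d)` is not. The converse vanishing, for `(c, d)` an edge and `(a, b)` not
(`PreservesEdges.mul_eq_zero_of_not_edge`), follows by counting: the positive elements
`q^c_a q^d_b q^c_a` over pairs of edges sum to `|E|`, which is also the sum over edges `(c, d)` and all
pairs `(a, b)`. Hence sums over edges in the matrix of `β` may be extended to all pairs of indices, and
bi-unitarity, co-associativity and `β(1) = 1` become the row and column relations of `q`. The density
conditions of a compact quantum group come from
`1 ⊗ q^a_b = ∑ c, (q^c_a ⊗ 1) Δ(q^c_b)` and its mirror image.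

For the second assertion, `C^Bic ⊆ C^sym` always holds, and it is to be shown that `C^sym ⊆ C^Bic` if
`Q` lies in `C^Bic`. Note that `Q` need not be universal in `C^sym`. Given an object of `C^sym` with
edge matrix `u^σ_τ`, its matrix `q^k_i` on the vertices is a quantum permutation matrix
(`RespectsBimodule.vertex_isMagic`), and `δ_{sr} q^k_i` satisfies the relations of `Q`
(`RespectsBimodule.qRel`). If the entries of `β` for `Q` are self-adjoint, so are therefore the products
`q^k_i q^l_j` for edges from `i` to `j` and from `k` to `l`, which means that these are projections. Now
`q^k_i q^l_j` is the sum of the `u^σ_τ` over the edges `σ` from `k` to `l`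
(`RespectsBimodule.sum_edgesBetween`), and by restricted orthogonality the summands have mutually
orthogonal ranges and supports; elements of this kind that sum to a projection are projections
(`isProjection_of_sum_eq_projection`). So `u` is a quantum permutation matrix of the edges.
-/

noncomputable section

/-! ### Families of projections in a C⋆-algebra -/

section Projections

variable {A : Type v} [CStarAlgebra A]

theorem eq_zero_of_sum_star_mul_self_eq_zero {ι : Type*} {s : Finset ι} {x : ι → A}
    (h : ∑ i ∈ s, star (x i) * x i = 0) {i : ι} (hi : i ∈ s) : x i = 0 := by
  let _ := CStarAlgebra.spectralOrder A
  have := CStarAlgebra.spectralOrderedRing A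
  have h0 := (Finset.sum_eq_zero_iff_of_nonneg fun i _ => star_mul_self_nonneg (x i)).1 h i hi
  exact CStarRing.star_mul_self_eq_zero_iff _ |>.1 h0

/-- Projections that sum to `1` are mutually orthogonal. -/
theorem mul_eq_zero_of_sum_eq_one {ι : Type*} [Fintype ι] {p : ι → A}
    (hsa : ∀ i, star (p i) = p i) (hid : ∀ i, p i * p i = p i) (hsum : ∑ i, p i = 1)
    {i j : ι} (hij : i ≠ j) : p i * p j = 0 := by
  classical
  have hj : p j * (∑ k, p k) * p j = p j := by rw [hsum, mul_one, hid]
  rw [← Finset.add_sum_erase _ _ (Finset.mem_univ j), mul_add, add_mul, hid, hid,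
    add_eq_left, Finset.mul_sum, Finset.sum_mul] at hj
  refine eq_zero_of_sum_star_mul_self_eq_zero (x := fun k => p k * p j) ?_
    (Finset.mem_erase.2 ⟨hij, Finset.mem_univ i⟩)
  rw [← hj]
  refine Finset.sum_congr rfl fun k _ => ?_
  rw [star_mul, hsa, hsa, mul_assoc (p j), ← mul_assoc (p k), hid, mul_assoc]

/-- If elements `u i` have mutually orthogonal ranges and mutually orthogonal supports, and their
sum is a projection `P`, then they are projections: `u⋆ u = u⋆ P` and `u u⋆ = u P`, so that `u⋆ u`
lies under `P`. -/
theorem isProjection_of_sum_eq_projection {ι : Type*} {s : Finset ι} {w : ι → A} {P : A}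
    (hP : star P = P) (hPP : P * P = P) (hsum : ∑ i ∈ s, w i = P)
    (hr : ∀ i ∈ s, ∀ j ∈ s, i ≠ j → w i * star (w j) = 0)
    (hl : ∀ i ∈ s, ∀ j ∈ s, i ≠ j → star (w i) * w j = 0) {i : ι} (hi : i ∈ s) :
    star (w i) = w i ∧ w i * w i = w i := by
  have h1 : star (w i) * P = star (w i) * w i := by
    rw [← hsum, Finset.mul_sum]
    exact Finset.sum_eq_single_of_mem i hi fun j hj hji => hl i hi j hj hji.symm
  have h2 : w i * P = w i * star (w i) := by
    rw [← hP, ← hsum, star_sum, Finset.mul_sum]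
    exact Finset.sum_eq_single_of_mem i hi fun j hj hji => hr i hi j hj hji.symm
  have h3 : star (w i) * (w i * P) = star (w i) * w i := by rw [← mul_assoc, ← h1, mul_assoc, hPP]
  have h4 : w i * P = w i := by
    rw [eq_comm, ← sub_eq_zero, ← CStarRing.star_mul_self_eq_zero_iff]
    simp only [star_sub, star_mul, hP, sub_mul, mul_sub, mul_assoc, h3, sub_self]
  have h5 : w i * star (w i) = w i := by rw [← h2, h4]
  have h6 : star (w i) = w i := by
    have := congrArg star h5
    rw [star_mul, star_star, h5] at this
    exact this.symm
  exact ⟨h6, by simpa [h6] using h5⟩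

end Projections

/-! ### Quantum permutation matrices -/

/-- A quantum permutation matrix (magic unitary): a square matrix of projections, those in the same
row or the same column being mutually orthogonal, with rows and columns that sum to `1`. -/
structure IsMagic {A : Type v} [Ring A] [StarRing A] {I : Type*} [Fintype I] (q : I → I → A) :
    Prop where
  selfAdjoint : ∀ a b, star (q a b) = q a b
  idem : ∀ a b, q a b * q a b = q a b
  row_orth : ∀ a b b', b ≠ b' → q a b * q a b' = 0
  col_orth : ∀ a a' b, a ≠ a' → q a b * q a' b = 0
  row_sum : ∀ a, ∑ b, q a b = 1
  col_sum : ∀ b, ∑ a, q a b = 1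

theorem IsMagic.of_sum_eq_one {A : Type v} [CStarAlgebra A] {I : Type*} [Fintype I]
    {q : I → I → A} (hsa : ∀ a b, star (q a b) = q a b) (hid : ∀ a b, q a b * q a b = q a b)
    (hrow : ∀ a, ∑ b, q a b = 1) (hcol : ∀ b, ∑ a, q a b = 1) : IsMagic q where
  selfAdjoint := hsa
  idem := hid
  row_orth a _ _ h := mul_eq_zero_of_sum_eq_one (hsa a) (hid a) (hrow a) h
  col_orth _ _ b h := mul_eq_zero_of_sum_eq_one (fun a => hsa a b) (fun a => hid a b) (hcol b) h
  row_sum := hrow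
  col_sum := hcol

section Coefficients

variable {A : Type u} [CStarAlgebra A] {X : Type u} [DecidableEq X]

theorem coeffMatrix_apply (γ : (X → ℂ) →ₗ[ℂ] (X → A)) (x y : X) :
    coeffMatrix γ x y = γ (Pi.single y 1) x := rfl

variable [Fintype X]

theorem apply_eq_sum_coeffMatrix (γ : (X → ℂ) →ₗ[ℂ] (X → A)) (f : X → ℂ) (x : X) :
    γ f x = ∑ y, f y • coeffMatrix γ x y := by
  conv_lhs => rw [pi_eq_sum_univ' f, map_sum, Finset.sum_apply]
  refine Finset.sum_congr rfl fun y _ => ?_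
  rw [map_smul, Pi.smul_apply]
  congr 2

/-- The linear map `ℂ^X → ℂ^X ⊗ A` with a given matrix of coefficients. -/
def ofCoeff (p : X → X → A) : (X → ℂ) →ₗ[ℂ] (X → A) where
  toFun f x := ∑ y, f y • p x y
  map_add' f g := by
    funext x
    simp only [Pi.add_apply, add_smul, Finset.sum_add_distrib]
  map_smul' c f := by
    funext x
    simp only [Pi.smul_apply, smul_eq_mul, mul_smul, Finset.smul_sum, RingHom.id_apply]

theorem coeffMatrix_ofCoeff (p : X → X → A) (x y : X) : coeffMatrix (ofCoeff p) x y = p x y := by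
  simp [coeffMatrix, ofCoeff, Pi.single_apply]

theorem MinTensor.tmul_smul {B : Type u} [CStarAlgebra B] (c : ℂ) (a : A) (b : B) :
    MinTensor.tmul a (c • b) = c • MinTensor.tmul a b := by
  simp [MinTensor.tmul]

theorem isCoassociative_of_coeffMatrix {Δ : A →⋆ₐ[ℂ] MinTensor A A}
    {γ : (X → ℂ) →ₗ[ℂ] (X → A)}
    (h : ∀ x y, Δ (coeffMatrix γ x y) =
      ∑ z, MinTensor.tmul (coeffMatrix γ x z) (coeffMatrix γ z y)) : IsCoassociative Δ γ := by
  intro f x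
  simp only [apply_eq_sum_coeffMatrix γ f, map_sum, map_smul, h, MinTensor.tmul_sum,
    MinTensor.tmul_smul, Finset.smul_sum]
  rw [Finset.sum_comm]
  rfl

/-- A co-associative map given by a quantum permutation matrix is a co-action. -/
theorem IsMagic.isAlgCoaction {Δ : A →⋆ₐ[ℂ] MinTensor A A} {γ : (X → ℂ) →ₗ[ℂ] (X → A)}
    (hm : IsMagic (coeffMatrix γ)) (hγ : IsCoassociative Δ γ) : IsAlgCoaction Δ γ where
  map_one := by
    funext x
    simp [apply_eq_sum_coeffMatrix, hm.row_sum]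
  map_mul f g := by
    funext x
    simp only [Pi.mul_apply, apply_eq_sum_coeffMatrix, Finset.sum_mul_sum]
    refine Finset.sum_congr rfl fun y _ => ?_
    rw [Finset.sum_eq_single y]
    · rw [smul_mul_smul_comm, hm.idem]
    · intro z _ hz
      rw [smul_mul_smul_comm, hm.row_orth _ _ _ hz.symm, smul_zero]
    · simp
  map_star f := by
    funext x
    simp [apply_eq_sum_coeffMatrix, hm.selfAdjoint]
  coassoc := hγ
  dense := by
    rw [Set.eq_univ_iff_forall]
    intro z
    apply subset_closure
    have hz : z = ∑ y, fun x => γ (Pi.single y 1) x * ∑ x', coeffMatrix γ x' y * z x' := by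
      funext x
      rw [Finset.sum_apply]
      have h : ∀ y, coeffMatrix γ x y * ∑ x', coeffMatrix γ x' y * z x' =
          coeffMatrix γ x y * z x := fun y => by
        rw [Finset.mul_sum, Finset.sum_eq_single x]
        · rw [← mul_assoc, hm.idem]
        · intro x' _ hx
          rw [← mul_assoc, hm.col_orth _ _ _ hx.symm, zero_mul]
        · simp
      exact ((Finset.sum_congr rfl fun y _ => h y).trans
        (by rw [← Finset.sum_mul, hm.row_sum, one_mul])).symm
    rw [hz]
    exact Submodule.sum_mem _ fun y _ => Submodule.subset_span ⟨_, _, rfl⟩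

variable {Δ : A →⋆ₐ[ℂ] MinTensor A A} {γ : (X → ℂ) →ₗ[ℂ] (X → A)}

theorem IsAlgCoaction.star_coeff (h : IsAlgCoaction Δ γ) (x y : X) :
    star (coeffMatrix γ x y) = coeffMatrix γ x y := by
  have := congrFun (h.map_star (Pi.single y 1)) x
  rw [show star (Pi.single y 1 : X → ℂ) = Pi.single y 1 by
    funext z; by_cases hz : z = y <;> simp [hz]] at this
  exact this.symm

theorem IsAlgCoaction.coeff_mul_coeff (h : IsAlgCoaction Δ γ) (x y z : X) :
    coeffMatrix γ x y * coeffMatrix γ x z = if y = z then coeffMatrix γ x y else 0 := by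
  have := congrFun (h.map_mul (Pi.single y 1) (Pi.single z 1)) x
  rw [Pi.mul_apply] at this
  simp only [coeffMatrix_apply]
  rw [← this]
  split_ifs with hyz
  · subst hyz
    rw [← Pi.single_mul, one_mul]
  · rw [show (Pi.single y 1 : X → ℂ) * Pi.single z 1 = 0 by
      funext w; by_cases hw : w = y
      · subst hw; simp [hyz]
      · simp [hw]]
    simp

theorem IsAlgCoaction.row_sum (h : IsAlgCoaction Δ γ) (x : X) : ∑ y, coeffMatrix γ x y = 1 := by
  have := congrFun h.map_one x
  rw [apply_eq_sum_coeffMatrix] at this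
  simpa using this

end Coefficients

/-! ### Quantum permutation matrices that preserve a set of edges -/

section Edges

variable {I E : Type*} [Fintype I] {s t : E → I}

theorem sum_sum_eq_sum_of_edges [Fintype E] {M : Type*} [AddCommMonoid M]
    (hinj : Function.Injective fun e => (s e, t e)) {F : I → I → M}
    (hF : ∀ a b, (∀ e, (s e, t e) ≠ (a, b)) → F a b = 0) :
    ∑ a, ∑ b, F a b = ∑ e, F (s e) (t e) := by
  classical
  rw [← Fintype.sum_prod_type' F]
  symm
  refine Finset.sum_of_injOn (fun e => (s e, t e)) hinj.injOn (by simp) ?_ fun _ _ => rfl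
  rintro ⟨a, b⟩ _ h
  exact hF a b fun e he => h ⟨e, by simp, he⟩

variable {A : Type v} [CStarAlgebra A] {q : I → I → A}

/-- The quantum permutation matrix `q` maps the edges given by the pairs `(s e, t e)` to edges:
`q^c_a q^d_b = 0` if `(a, b)` is an edge and `(c, d)` is not. -/
structure PreservesEdges (q : I → I → A) (s t : E → I) : Prop where
  inj : Function.Injective fun e => (s e, t e)
  magic : IsMagic q
  mul_eq_zero : ∀ e c d, (∀ e', (s e', t e') ≠ (c, d)) → q c (s e) * q d (t e) = 0

namespace PreservesEdges

theorem swap (h : PreservesEdges q s t) : PreservesEdges q t s where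
  inj e e' he := h.inj (by simp_all)
  magic := h.magic
  mul_eq_zero e c d hcd := by
    have := congrArg star (h.mul_eq_zero e d c fun e' he => hcd e' (by simp_all))
    simpa [h.magic.selfAdjoint] using this

variable [Fintype E]

/-- Non-edges are mapped to non-edges as well. The sum of the positive elements `x⋆ x`, with
`x = q^d_b q^c_a` and both `(a, b)` and `(c, d)` ranging over edges, is the number of edges; this
leaves nothing for the terms with an edge `(c, d)` and a non-edge `(a, b)`. -/
theorem mul_eq_zero_of_not_edge (h : PreservesEdges q s t) (e : E) (a b : I)
    (hab : ∀ e', (s e', t e') ≠ (a, b)) : q (s e) a * q (t e) b = 0 := by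
  classical
  have hm := h.magic
  have hX : ∀ a b c d, star (q d b * q c a) * (q d b * q c a) = q c a * q d b * q c a :=
    fun a b c d => by
      rw [star_mul, hm.selfAdjoint, hm.selfAdjoint, mul_assoc, ← mul_assoc (q d b), hm.idem,
        mul_assoc]
  have h1 : ∑ c : E, ∑ a : E, q (s c) (s a) * q (t c) (t a) * q (s c) (s a) =
      ∑ _ : E, (1 : A) := by
    rw [Finset.sum_comm]
    refine Finset.sum_congr rfl fun a _ => ?_
    rw [← sum_sum_eq_sum_of_edges (F := fun c d => q c (s a) * q d (t a) * q c (s a)) h.inj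
      fun c d hcd => by rw [h.mul_eq_zero a c d hcd, zero_mul]]
    simp only [← Finset.mul_sum, ← Finset.sum_mul, hm.col_sum, mul_one, hm.idem]
  have h2 : ∑ c : E, ∑ p : I × I, q (s c) p.1 * q (t c) p.2 * q (s c) p.1 =
      ∑ _ : E, (1 : A) := by
    refine Finset.sum_congr rfl fun c _ => ?_
    rw [Fintype.sum_prod_type]
    simp only [← Finset.mul_sum, ← Finset.sum_mul, hm.row_sum, mul_one, hm.idem]
  let N : Finset (I × I) := {p | ∀ e', (s e', t e') ≠ p}
  have h3 : ∀ c : E, ∑ p : I × I, q (s c) p.1 * q (t c) p.2 * q (s c) p.1 =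
      ∑ a : E, q (s c) (s a) * q (t c) (t a) * q (s c) (s a) +
        ∑ p ∈ N, q (s c) p.1 * q (t c) p.2 * q (s c) p.1 := fun c => by
    rw [← Finset.sum_filter_not_add_sum_filter _ fun p : I × I => ∀ e', (s e', t e') ≠ p]
    congr 1
    symm
    refine Finset.sum_of_injOn (fun e => (s e, t e)) h.inj.injOn ?_ ?_ fun _ _ => rfl
    · intro e _
      simp only [Finset.coe_filter, Set.mem_ofPred_eq, Finset.mem_univ, true_and, not_forall, not_not]
      exact ⟨e, rfl⟩
    · rintro p hp hp'
      exfalso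
      simp only [Finset.mem_filter, not_forall, not_not] at hp
      obtain ⟨_, e', he'⟩ := hp
      exact hp' ⟨e', by simp, he'⟩
  simp only [h3, Finset.sum_add_distrib, h1, add_eq_left] at h2
  rw [← Finset.sum_product'] at h2
  have h4 := eq_zero_of_sum_star_mul_self_eq_zero
    (x := fun z : E × I × I => q (t z.1) z.2.2 * q (s z.1) z.2.1)
    (s := Finset.univ ×ˢ N) (i := (e, a, b)) (by simpa only [hX] using h2)
    (by simpa [N] using fun e' => by simpa using hab e')
  simpa [hm.selfAdjoint] using congrArg star h4

theorem sum_star_mul_col [DecidableEq E] (h : PreservesEdges q s t) (a b : E) :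
    ∑ e, star (q (s e) (s a) * q (t e) (t a)) * (q (s e) (s b) * q (t e) (t b)) =
      if a = b then 1 else 0 := by
  have hm := h.magic
  simp only [star_mul, hm.selfAdjoint]
  rw [← sum_sum_eq_sum_of_edges (F := fun c d => q d (t a) * q c (s a) * (q c (s b) * q d (t b)))
    h.inj fun c d hcd => by rw [h.mul_eq_zero b c d hcd, mul_zero], Finset.sum_comm]
  have hc : ∀ c d, q d (t a) * q c (s a) * (q c (s b) * q d (t b)) =
      q d (t a) * (q c (s a) * q c (s b)) * q d (t b) := fun c d => by simp only [mul_assoc]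
  simp only [hc, ← Finset.sum_mul, ← Finset.mul_sum]
  split_ifs with hab
  · subst hab
    simp [hm.idem, hm.col_sum]
  · by_cases hs : s a = s b
    · have ht : t a ≠ t b := fun ht => hab (h.inj (by simp [hs, ht]))
      simp [hs, hm.idem, hm.col_sum, hm.row_orth _ _ _ ht]
    · simp [hm.row_orth _ _ _ hs]

theorem sum_mul_star_row [DecidableEq E] (h : PreservesEdges q s t) (a b : E) :
    ∑ e, (q (s a) (s e) * q (t a) (t e)) * star (q (s b) (s e) * q (t b) (t e)) =
      if a = b then 1 else 0 := by
  have hm := h.magic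
  simp only [star_mul, hm.selfAdjoint]
  rw [← sum_sum_eq_sum_of_edges (F := fun c d => q (s a) c * q (t a) d * (q (t b) d * q (s b) c))
    h.inj fun c d hcd => by rw [h.mul_eq_zero_of_not_edge a c d hcd, zero_mul]]
  have hc : ∀ c d, q (s a) c * q (t a) d * (q (t b) d * q (s b) c) =
      q (s a) c * (q (t a) d * q (t b) d) * q (s b) c := fun c d => by simp only [mul_assoc]
  simp only [hc, ← Finset.sum_mul, ← Finset.mul_sum]
  split_ifs with hab
  · subst hab
    simp [hm.idem, hm.row_sum]
  · by_cases ht : t a = t b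
    · have hs : s a ≠ s b := fun hs => hab (h.inj (by simp [hs, ht]))
      simp [ht, hm.idem, hm.row_sum, hm.col_orth _ _ _ hs]
    · simp [hm.col_orth _ _ _ ht]

theorem sum_row (h : PreservesEdges q s t) (a : E) :
    ∑ e, q (s a) (s e) * q (t a) (t e) = 1 := by
  rw [← sum_sum_eq_sum_of_edges (F := fun c d => q (s a) c * q (t a) d) h.inj
    (h.mul_eq_zero_of_not_edge a)]
  simp only [← Finset.mul_sum, h.magic.row_sum, mul_one]

theorem mem_unitary [DecidableEq E] (h : PreservesEdges q s t) :
    Matrix.of (fun a b => q (s a) (s b) * q (t a) (t b)) ∈ unitary (Matrix E E A) := by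
  rw [Unitary.mem_iff]
  constructor <;> ext a b
  · rw [Matrix.mul_apply, Matrix.one_apply, ← h.sum_star_mul_col]
    rfl
  · rw [Matrix.mul_apply, Matrix.one_apply, ← h.sum_mul_star_row]
    rfl

end PreservesEdges

end Edges

/-! ### Density of elementary tensors, and of the generators of `Q` -/

section Density

variable {A B : Type u} [CStarAlgebra A] [CStarAlgebra B]

/-- The ⋆-homomorphism `b ↦ 1 ⊗ b`. -/
def MinTensor.inclRight : B →⋆ₐ[ℂ] MinTensor A B where
  toFun b := MinTensor.tmul 1 b
  map_one' := MinTensor.one_tmul_one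
  map_mul' b c := by rw [MinTensor.tmul_mul_tmul, one_mul]
  map_zero' := MinTensor.tmul_zero 1
  map_add' b c := by simp [MinTensor.tmul, TensorProduct.tmul_add]
  commutes' c := by
    rw [Algebra.algebraMap_eq_smul_one, MinTensor.tmul_smul, MinTensor.one_tmul_one,
      Algebra.algebraMap_eq_smul_one]
  map_star' b := by rw [MinTensor.star_tmul, star_one]

/-- The ⋆-homomorphism `a ↦ a ⊗ 1`. -/
def MinTensor.inclLeft : A →⋆ₐ[ℂ] MinTensor A B where
  toFun a := MinTensor.tmul a 1
  map_one' := MinTensor.one_tmul_one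
  map_mul' b c := by rw [MinTensor.tmul_mul_tmul, one_mul]
  map_zero' := MinTensor.zero_tmul 1
  map_add' b c := by simp [MinTensor.tmul, TensorProduct.add_tmul]
  commutes' c := by
    rw [Algebra.algebraMap_eq_smul_one, Algebra.algebraMap_eq_smul_one, ← MinTensor.one_tmul_one,
      ← MinTensor.tmul_smul, MinTensor.tmul, MinTensor.tmul, TensorProduct.smul_tmul]
  map_star' b := by rw [MinTensor.star_tmul, star_one]

open scoped CStarAlgebra in
theorem StarAlgHom.continuous_of_cstarAlgebra (f : A →⋆ₐ[ℂ] B) : Continuous f :=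
  map_continuous f

theorem MinTensor.continuous_tmul_right (a : A) :
    Continuous fun b : B => MinTensor.tmul a b := by
  have h : (fun b : B => MinTensor.tmul a b) =
      fun b => MinTensor.tmul a 1 * MinTensor.inclRight b := by
    funext b
    change _ = MinTensor.tmul a 1 * MinTensor.tmul 1 b
    rw [MinTensor.tmul_mul_tmul, mul_one, one_mul]
  rw [h]
  exact (MinTensor.inclRight.continuous_of_cstarAlgebra).const_mul _

theorem MinTensor.continuous_tmul_left (b : B) :
    Continuous fun a : A => MinTensor.tmul a b := by
  have h : (fun a : A => MinTensor.tmul a b) =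
      fun a => MinTensor.inclLeft a * MinTensor.tmul 1 b := by
    funext a
    change _ = MinTensor.tmul a 1 * MinTensor.tmul 1 b
    rw [MinTensor.tmul_mul_tmul, mul_one, one_mul]
  rw [h]
  exact (MinTensor.inclLeft.continuous_of_cstarAlgebra).mul_const _

/-- A closed subspace that contains all elementary tensors is the whole tensor product. -/
theorem MinTensor.mem_of_tmul_mem {S : Submodule ℂ (MinTensor A B)}
    (hS : IsClosed (S : Set (MinTensor A B))) (h : ∀ a b, MinTensor.tmul a b ∈ S)
    (x : MinTensor A B) : x ∈ S := by
  refine CStarSeminorm.compl_induction (minNorm A B) (P := fun x => x ∈ S) hS (fun y => ?_) x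
  change incl A B y ∈ S
  induction y using TensorProduct.induction_on with
  | zero => rw [map_zero]; exact S.zero_mem
  | add y z hy hz => rw [map_add]; exact S.add_mem hy hz
  | tmul a b => exact h a b

theorem mul_mem_topologicalClosure_span (f : A → B) (Δ : A →⋆ₐ[ℂ] B) {z : B}
    (hz : z ∈ (Submodule.span ℂ {x | ∃ a b, x = f a * Δ b}).topologicalClosure) (b : A) :
    z * Δ b ∈ (Submodule.span ℂ {x | ∃ a b, x = f a * Δ b}).topologicalClosure := by
  refine map_mem_closure (f := fun w => w * Δ b) (continuous_mul_const _) hz fun w hw => ?_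
  refine Submodule.span_induction
    (p := fun w _ => w * Δ b ∈ Submodule.span ℂ {x | ∃ a b, x = f a * Δ b}) ?_ ?_ ?_ ?_ hw
  · rintro _ ⟨a, c, rfl⟩
    exact Submodule.subset_span ⟨a, c * b, by rw [map_mul, mul_assoc]⟩
  · simp
  · intro x y _ _ hx hy
    rw [add_mul]
    exact Submodule.add_mem _ hx hy
  · intro c x _ hx
    rw [smul_mul_assoc]
    exact Submodule.smul_mem _ c hx

end Density

namespace Multigraph

variable {V E : Type u} [Fintype V] [DecidableEq V] [Fintype E] {G : Multigraph V E}

section Generators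

variable (L : G.EdgeLabeling)

/-- `Q` is generated by the `q^{ks}_{ir}` as a Banach algebra. -/
theorem Q.mem_of_q_mem {S : Subalgebra ℂ (Q L)} (hS : IsClosed (S : Set (Q L)))
    (h : ∀ a b, Q.q L a b ∈ S) (x : Q L) : x ∈ S := by
  refine CStarSeminorm.compl_induction (univNorm L) (P := fun x => x ∈ S) hS (fun y => ?_) x
  let m : FreeStar G →ₐ[ℂ] Q L := ((univNorm L).toComplHom : FreeStar G →⋆ₐ[ℂ] Q L).toAlgHom
  change m y ∈ S
  induction y using TensorProduct.induction_on with
  | zero => rw [map_zero]; exact S.zero_mem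
  | add y z hy hz => rw [map_add]; exact S.add_mem hy hz
  | tmul c y =>
    have hc : c ⊗ₜ[ℝ] y = c • ((1 : ℂ) ⊗ₜ[ℝ] y) := by simp [TensorProduct.smul_tmul']
    rw [hc, map_smul]
    refine S.smul_mem ?_ c
    clear hc
    induction y using FreeAlgebra.induction with
    | grade0 r =>
      have hr : (1 : ℂ) ⊗ₜ[ℝ] algebraMap ℝ (FreeAlgebra ℝ (Idx G × Idx G)) r =
          algebraMap ℂ (FreeStar G) r := by
        rw [Algebra.algebraMap_eq_smul_one, ← TensorProduct.smul_tmul]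
        simp [Algebra.TensorProduct.algebraMap_apply]
      rw [hr, AlgHom.commutes]
      exact S.algebraMap_mem _
    | grade1 z => exact h z.1 z.2
    | mul y z hy hz =>
      have hyz : (1 : ℂ) ⊗ₜ[ℝ] (y * z) = ((1 : ℂ) ⊗ₜ[ℝ] y) * ((1 : ℂ) ⊗ₜ[ℝ] z) := by simp
      rw [hyz, map_mul]
      exact S.mul_mem hy hz
    | add y z hy hz =>
      rw [TensorProduct.tmul_add, map_add]
      exact S.add_mem hy hz

theorem QRel.isMagic {L : G.EdgeLabeling} {B : Type v} [Ring B] [StarRing B]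
    {q : Idx G → Idx G → B} (h : QRel L q) : IsMagic q :=
  ⟨h.selfAdjoint, h.idem, h.row_orth, h.col_orth, h.row_sum, h.col_sum⟩

theorem EdgeLabeling.eq_of_label_eq {e e' : E} (hs : G.source e = G.source e')
    (ht : G.target e = G.target e') (hl : L.label e = L.label e') : e = e' :=
  (L.bijOn (G.source e) (G.target e)).injOn (by simp [edgesBetween])
    (by simp [edgesBetween, hs, ht]) hl

theorem QRel.preservesEdges {L : G.EdgeLabeling} (hG : G.IsUniform) {B : Type v} [CStarAlgebra B]
    {q : Idx G → Idx G → B} (h : QRel L q) : PreservesEdges q L.srcIdx L.tgtIdx where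
  inj e e' he := by
    simp only [EdgeLabeling.srcIdx, EdgeLabeling.tgtIdx, Prod.mk.injEq] at he
    exact L.eq_of_label_eq he.1.1 he.2.1 he.1.2
  magic := h.isMagic
  mul_eq_zero := by
    rintro e ⟨k, r⟩ ⟨l, r'⟩ hcd
    rcases (G.edgesBetween k l).eq_empty_or_nonempty with h0 | h0
    · exact h.edge e k l r r' h0
    · refine h.label e k l r r' ?_
      rintro rfl
      obtain ⟨e', rfl, rfl, rfl⟩ := L.exists_edge hG h0 r
      exact hcd e' rfl

end Generators

/-! ### `Q` is a compact quantum group -/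

section CQG

variable (L : G.EdgeLabeling) (hG : G.IsUniform)

theorem Q.nontrivial : Nontrivial (Q L) := by
  classical
  have h : QRel L fun a b : Idx G => if a = b then (1 : ℂ) else 0 :=
    { selfAdjoint := fun a b => by split_ifs <;> simp
      idem := fun a b => by split_ifs <;> simp
      row_orth := fun a b b' hb => by
        split_ifs with h1 h2
        · exact absurd (h1.symm.trans h2) hb
        all_goals simp
      col_orth := fun a b b' hb => by
        split_ifs with h1 h2
        · exact absurd (h1.trans h2.symm) hb
        all_goals simp
      row_sum := fun a => by simp
      col_sum := fun a => by simp
      fibre := fun k i s s' => by by_cases hk : k = i <;> simp [hk]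
      edge := fun τ k l s s' h0 => by
        split_ifs with h1 h2
        · simp only [Prod.mk.injEq] at h1 h2
          have : τ ∈ G.edgesBetween k l := by simp [edgesBetween, h1.1, h2.1]
          simp [h0] at this
        all_goals simp
      label := fun τ k l s s' hs => by
        split_ifs with h1 h2
        · simp only [Prod.mk.injEq] at h1 h2
          exact absurd (h1.2.trans h2.2.symm) hs
        all_goals simp }
  exact (Q.lift L h).toRingHom.domain_nontrivial

theorem Q.coassoc (x : Q L) :
    MinTensor.AssocRel (MinTensor.map (Q.comul L hG) (StarAlgHom.id ℂ _) (Q.comul L hG x))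
      (MinTensor.map (StarAlgHom.id ℂ _) (Q.comul L hG) (Q.comul L hG x)) := by
  let F := (MinTensor.map (Q.comul L hG) (StarAlgHom.id ℂ _)).comp (Q.comul L hG)
  let F' := (MinTensor.map (StarAlgHom.id ℂ _) (Q.comul L hG)).comp (Q.comul L hG)
  -- The graph of the identification is a closed subalgebra, since the pairs that span it are
  -- closed under multiplication.
  let T : Submonoid (MinTensor (MinTensor (Q L) (Q L)) (Q L) ×
      MinTensor (Q L) (MinTensor (Q L) (Q L))) :=
    { carrier := {z | ∃ (a : Q L) (b : Q L) (c : Q L),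
        z = (MinTensor.tmul (MinTensor.tmul a b) c, MinTensor.tmul a (MinTensor.tmul b c))}
      one_mem' := ⟨1, 1, 1, by simp only [MinTensor.one_tmul_one]; rfl⟩
      mul_mem' := by
        rintro _ _ ⟨a, b, c, rfl⟩ ⟨a', b', c', rfl⟩
        exact ⟨a * a', b * b', c * c', by simp only [Prod.mk_mul_mk, MinTensor.tmul_mul_tmul]⟩ }
  let R := (Algebra.adjoin ℂ (T : Set (MinTensor (MinTensor (Q L) (Q L)) (Q L) ×
      MinTensor (Q L) (MinTensor (Q L) (Q L))))).topologicalClosure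
  have hR : (R : Set (MinTensor (MinTensor (Q L) (Q L)) (Q L) ×
      MinTensor (Q L) (MinTensor (Q L) (Q L)))) =
      closure ↑(Submodule.span ℂ (T : Set (MinTensor (MinTensor (Q L) (Q L)) (Q L) ×
        MinTensor (Q L) (MinTensor (Q L) (Q L))))) := by
    rw [Subalgebra.topologicalClosure_coe, ← Subalgebra.coe_toSubmodule, Algebra.adjoin_eq_span,
      Submonoid.closure_eq]
  suffices h : x ∈ R.comap (F.toAlgHom.prod F'.toAlgHom) by
    change (F x, F' x) ∈ closure _
    have h' : (F x, F' x) ∈ (R : Set _) := h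
    rwa [hR] at h'
  refine Q.mem_of_q_mem L ?_ (fun a b => ?_) x
  · exact (Subalgebra.isClosed_topologicalClosure _).preimage
      (F.continuous_of_cstarAlgebra.prodMk F'.continuous_of_cstarAlgebra)
  · change (F (Q.q L a b), F' (Q.q L a b)) ∈ R
    have h1 : F (Q.q L a b) = ∑ c, ∑ d, MinTensor.tmul
        (MinTensor.tmul (Q.q L a c) (Q.q L c d)) (Q.q L d b) := by
      change MinTensor.map _ _ (Q.comul L hG _) = _
      simp only [Q.comul_q, map_sum, MinTensor.map_tmul, MinTensor.sum_tmul, StarAlgHom.coe_id,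
        id]
      rw [Finset.sum_comm]
    have h2 : F' (Q.q L a b) = ∑ c, ∑ d, MinTensor.tmul
        (Q.q L a c) (MinTensor.tmul (Q.q L c d) (Q.q L d b)) := by
      change MinTensor.map _ _ (Q.comul L hG _) = _
      simp only [Q.comul_q, map_sum, MinTensor.map_tmul, MinTensor.tmul_sum, StarAlgHom.coe_id,
        id]
    have h3 : (F (Q.q L a b), F' (Q.q L a b)) = ∑ c, ∑ d,
        (MinTensor.tmul (MinTensor.tmul (Q.q L a c) (Q.q L c d)) (Q.q L d b),
          MinTensor.tmul (Q.q L a c) (MinTensor.tmul (Q.q L c d) (Q.q L d b))) := by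
      apply Prod.ext <;> simp only [Prod.fst_sum, Prod.snd_sum, h1, h2]
    rw [h3]
    exact Subalgebra.sum_mem _ fun c _ => Subalgebra.sum_mem _ fun d _ =>
      Subalgebra.le_topologicalClosure _ (Algebra.subset_adjoin ⟨_, _, _, rfl⟩)

/-- A closed subspace of `Q` stable under right multiplication by the generators, and containing
`1`, is all of `Q`. -/
theorem Q.mem_of_mul_q_mem {M : Submodule ℂ (Q L)} (hM : IsClosed (M : Set (Q L)))
    (h1 : 1 ∈ M) (h : ∀ y ∈ M, ∀ a b, y * Q.q L a b ∈ M) (x : Q L) : x ∈ M := by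
  let S : Subalgebra ℂ (Q L) :=
    { carrier := {x | ∀ y ∈ M, y * x ∈ M}
      mul_mem' := fun {x x'} hx hx' y hy => by rw [← mul_assoc]; exact hx' _ (hx y hy)
      add_mem' := fun {x x'} hx hx' y hy => by rw [mul_add]; exact M.add_mem (hx y hy) (hx' y hy)
      algebraMap_mem' := fun c y hy => by
        rw [← Algebra.commutes, ← Algebra.smul_def]
        exact M.smul_mem c hy }
  have hS : IsClosed (S : Set (Q L)) := by
    change IsClosed {x | ∀ y ∈ M, y * x ∈ M}
    simp only [Set.ofPred_forall]
    exact isClosed_iInter fun y => isClosed_iInter fun _ =>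
      hM.preimage (continuous_const_mul y)
  simpa using Q.mem_of_q_mem L hS (fun a b y hy => h y hy a b) x 1 h1

theorem Q.dense_left : closure (Submodule.span ℂ
    {x | ∃ a b : Q L, x = MinTensor.tmul a 1 * Q.comul L hG b} : Set (MinTensor (Q L) (Q L))) =
      Set.univ := by
  let S := Submodule.span ℂ
    {x | ∃ a b : Q L, x = MinTensor.tmul a 1 * Q.comul L hG b}
  let D := S.topologicalClosure
  have hDc : IsClosed (D : Set (MinTensor (Q L) (Q L))) := S.isClosed_topologicalClosure
  have hDmul : ∀ z ∈ D, ∀ b, z * Q.comul L hG b ∈ D := fun z hz b =>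
    mul_mem_topologicalClosure_span _ _ hz b
  -- `M` consists of the `y` for which all `x ⊗ y` lie in the closed span `D`.
  let M : Submodule ℂ (Q L) :=
    { carrier := {y | ∀ x, MinTensor.tmul x y ∈ D}
      zero_mem' := fun x => by rw [MinTensor.tmul_zero]; exact D.zero_mem
      add_mem' := fun {y y'} hy hy' x => by
        rw [MinTensor.tmul, TensorProduct.tmul_add, map_add]
        exact D.add_mem (hy x) (hy' x)
      smul_mem' := fun c y hy x => by
        rw [MinTensor.tmul_smul]
        exact D.smul_mem c (hy x) }
  have hM : IsClosed (M : Set (Q L)) := by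
    change IsClosed {y | ∀ x, MinTensor.tmul x y ∈ D}
    simp only [Set.ofPred_forall]
    exact isClosed_iInter fun x => hDc.preimage (MinTensor.continuous_tmul_right x)
  have hMtop : ∀ y, y ∈ M := by
    refine Q.mem_of_mul_q_mem L hM (fun x => ?_) fun y hy a b x => ?_
    · exact S.le_topologicalClosure (Submodule.subset_span ⟨x, 1, by rw [map_one, mul_one]⟩)
    · -- `1 ⊗ q^a_b = ∑ c, (q^c_a ⊗ 1) Δ(q^c_b)`, by orthogonality of the rows.
      have key : MinTensor.tmul x (y * Q.q L a b) =
          ∑ c, MinTensor.tmul (x * Q.q L c a) y * Q.comul L hG (Q.q L c b) := by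
        simp only [Q.comul_q, Finset.mul_sum, MinTensor.tmul_mul_tmul, mul_assoc]
        rw [Finset.sum_comm, Finset.sum_eq_single a]
        · simp only [(Q.rel L).idem, ← MinTensor.sum_tmul, ← Finset.mul_sum, (Q.rel L).col_sum,
            mul_one]
        · intro d _ hd
          refine Finset.sum_eq_zero fun c _ => ?_
          rw [(Q.rel L).row_orth _ _ _ hd.symm, mul_zero, MinTensor.zero_tmul]
        · simp
      rw [key]
      exact D.sum_mem fun c _ => hDmul _ (hy _) _
  exact Set.eq_univ_of_forall (MinTensor.mem_of_tmul_mem hDc fun a b => hMtop b a)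

theorem Q.dense_right : closure (Submodule.span ℂ
    {x | ∃ a b : Q L, x = MinTensor.tmul 1 a * Q.comul L hG b} : Set (MinTensor (Q L) (Q L))) =
      Set.univ := by
  let S := Submodule.span ℂ
    {x | ∃ a b : Q L, x = MinTensor.tmul 1 a * Q.comul L hG b}
  let D := S.topologicalClosure
  have hDc : IsClosed (D : Set (MinTensor (Q L) (Q L))) := S.isClosed_topologicalClosure
  have hDmul : ∀ z ∈ D, ∀ b, z * Q.comul L hG b ∈ D := fun z hz b =>
    mul_mem_topologicalClosure_span _ _ hz b
  let M : Submodule ℂ (Q L) :=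
    { carrier := {x | ∀ y, MinTensor.tmul x y ∈ D}
      zero_mem' := fun y => by rw [MinTensor.zero_tmul]; exact D.zero_mem
      add_mem' := fun {x x'} hx hx' y => by
        rw [MinTensor.tmul, TensorProduct.add_tmul, map_add]
        exact D.add_mem (hx y) (hx' y)
      smul_mem' := fun c x hx y => by
        rw [MinTensor.tmul, ← TensorProduct.smul_tmul', map_smul]
        exact D.smul_mem c (hx y) }
  have hM : IsClosed (M : Set (Q L)) := by
    change IsClosed {x | ∀ y, MinTensor.tmul x y ∈ D}
    simp only [Set.ofPred_forall]
    exact isClosed_iInter fun y => hDc.preimage (MinTensor.continuous_tmul_left y)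
  have hMtop : ∀ y, y ∈ M := by
    refine Q.mem_of_mul_q_mem L hM (fun y => ?_) fun x hx a b y => ?_
    · exact S.le_topologicalClosure (Submodule.subset_span ⟨y, 1, by rw [map_one, mul_one]⟩)
    · -- `q^a_b ⊗ 1 = ∑ d, (1 ⊗ q^b_d) Δ(q^a_d)`, by orthogonality of the columns.
      have key : MinTensor.tmul (x * Q.q L a b) y =
          ∑ d, MinTensor.tmul x (y * Q.q L b d) * Q.comul L hG (Q.q L a d) := by
        simp only [Q.comul_q, Finset.mul_sum, MinTensor.tmul_mul_tmul, mul_assoc]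
        rw [Finset.sum_comm, Finset.sum_eq_single b]
        · simp only [(Q.rel L).idem, ← MinTensor.tmul_sum, ← Finset.mul_sum, (Q.rel L).row_sum,
            mul_one]
        · intro e _ he
          refine Finset.sum_eq_zero fun c _ => ?_
          rw [(Q.rel L).col_orth _ _ _ he.symm, mul_zero, MinTensor.tmul_zero]
        · simp
      rw [key]
      exact D.sum_mem fun c _ => hDmul _ (hx _) _
  exact Set.eq_univ_of_forall (MinTensor.mem_of_tmul_mem hDc fun a b => hMtop a b)

theorem Q.isCQG : IsCQG (Q.comul L hG) where
  nontrivial := Q.nontrivial L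
  coassoc := Q.coassoc L hG
  dense_left := Q.dense_left L hG
  dense_right := Q.dense_right L hG

end CQG

end Multigraph

/-! ### The co-action of `Q` on the multigraph -/

namespace Multigraph

variable {V E : Type u} [Fintype V] [DecidableEq V] [Fintype E] {G : Multigraph V E}
  (L : G.EdgeLabeling)

section EdgeMap

variable [DecidableEq E]

theorem Q.coeffMatrix_edgeMap (σ τ : E) : coeffMatrix (Q.edgeMap L) σ τ =
    Q.q L (L.srcIdx σ) (L.srcIdx τ) * Q.q L (L.tgtIdx σ) (L.tgtIdx τ) := by
  simp [coeffMatrix, Q.edgeMap, Pi.single_apply]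

theorem Q.isBiunitaryCorep (hG : G.IsUniform) : IsBiunitaryCorep (Q.comul L hG) (Q.edgeMap L) where
  coassoc := by
    refine isCoassociative_of_coeffMatrix fun σ τ => ?_
    simp only [Q.coeffMatrix_edgeMap, map_mul, Q.comul_q, Finset.sum_mul_sum,
      MinTensor.tmul_mul_tmul]
    refine sum_sum_eq_sum_of_edges (F := fun c d => MinTensor.tmul
      (Q.q L (L.srcIdx σ) c * Q.q L (L.tgtIdx σ) d) (Q.q L c (L.srcIdx τ) * Q.q L d (L.tgtIdx τ)))
      ((Q.rel L).preservesEdges hG).inj fun c d hcd => ?_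
    rw [((Q.rel L).preservesEdges hG).mul_eq_zero τ c d hcd, MinTensor.tmul_zero]
  isUnitary := by
    have h := ((Q.rel L).preservesEdges hG).mem_unitary
    convert h using 1
    ext σ τ
    exact Q.coeffMatrix_edgeMap L σ τ
  conj_isUnitary := by
    -- Taking adjoints of the entries amounts to exchanging sources and targets.
    have h := ((Q.rel L).preservesEdges hG).swap.mem_unitary
    convert h using 1
    ext σ τ
    simp [Q.coeffMatrix_edgeMap, (Q.rel L).selfAdjoint]

theorem Q.edgeMap_one (hG : G.IsUniform) : Q.edgeMap L 1 = 1 := by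
  funext σ
  rw [apply_eq_sum_coeffMatrix]
  simp only [Pi.one_apply, one_smul, Q.coeffMatrix_edgeMap]
  exact ((Q.rel L).preservesEdges hG).sum_row σ

theorem Q.restrictedOrthogonality : G.RestrictedOrthogonality (Q.edgeMap L) := by
  intro σ σ' τ hne hs ht
  have hl : L.label σ ≠ L.label σ' := fun hl => hne (L.eq_of_label_eq hs ht hl)
  have hsrc : L.srcIdx σ ≠ L.srcIdx σ' := fun h => hl (congrArg Prod.snd h)
  have htgt : L.tgtIdx σ ≠ L.tgtIdx σ' := fun h => hl (congrArg Prod.snd h)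
  have hQ := Q.rel L
  simp only [Q.coeffMatrix_edgeMap, star_mul, hQ.selfAdjoint]
  constructor
  · rw [mul_assoc, ← mul_assoc (Q.q L (L.tgtIdx σ) _), hQ.col_orth _ _ _ htgt, zero_mul, mul_zero]
  · rw [mul_assoc, ← mul_assoc (Q.q L (L.srcIdx σ) _), hQ.col_orth _ _ _ hsrc, zero_mul, mul_zero]

end EdgeMap

/-- The entry `∑ r, q^{ks}_{ir}` of the quantum permutation matrix of the vertices. It does not
depend on `s`, for which the label of some edge at `k` is taken. -/
def Q.vertexCoeff (k i : V) : Q L :=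
  ∑ r, Q.q L (k, L.label (G.no_isolated k).choose) (i, r)

theorem Q.sum_q_eq_vertexCoeff (k i : V) (s : Fin G.maxMult) :
    ∑ r, Q.q L (k, s) (i, r) = Q.vertexCoeff L k i :=
  (Q.rel L).fibre k i _ _

theorem Q.vertexCoeff_isMagic : IsMagic (Q.vertexCoeff L) := by
  have hQ := Q.rel L
  refine .of_sum_eq_one (fun k i => ?_) (fun k i => ?_) (fun k => ?_) fun i => ?_
  · simp only [Q.vertexCoeff, star_sum, hQ.selfAdjoint]
  · rw [Q.vertexCoeff, Finset.sum_mul_sum]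
    refine Finset.sum_congr rfl fun r _ => ?_
    rw [Finset.sum_eq_single r]
    · exact hQ.idem _ _
    · intro r' _ hr
      exact hQ.row_orth _ _ _ (by simpa using hr.symm)
    · simp
  · simp only [Q.vertexCoeff]
    rw [← Fintype.sum_prod_type]
    exact hQ.row_sum _
  · -- Both sides agree after multiplication by the number `N` of labels.
    have hN : (G.maxMult : ℂ) ≠ 0 := by
      have : 0 < G.maxMult := (Nat.zero_le _).trans_lt (L.label (G.no_isolated i).choose).2
      exact_mod_cast this.ne'
    have h1 : ∑ k, ∑ s : Fin G.maxMult, ∑ r, Q.q L (k, s) (i, r) =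
        (G.maxMult : ℂ) • ∑ k, Q.vertexCoeff L k i := by
      simp only [Q.sum_q_eq_vertexCoeff, Finset.sum_const, Finset.card_univ, Fintype.card_fin,
        Finset.smul_sum, Nat.cast_smul_eq_nsmul]
    have h2 : ∑ k, ∑ s : Fin G.maxMult, ∑ r, Q.q L (k, s) (i, r) =
        (G.maxMult : ℂ) • (1 : Q L) := by
      rw [← Fintype.sum_prod_type', Finset.sum_comm]
      simp only [hQ.col_sum, Finset.sum_const, Finset.card_univ, Fintype.card_fin,
        Nat.cast_smul_eq_nsmul]
    exact smul_right_injective _ hN (h1.symm.trans h2)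

theorem Q.vertex_isAlgCoaction (hG : G.IsUniform) :
    IsAlgCoaction (Q.comul L hG) (ofCoeff (Q.vertexCoeff L)) := by
  have hc : coeffMatrix (ofCoeff (Q.vertexCoeff L)) = Q.vertexCoeff L := by
    ext k i
    exact coeffMatrix_ofCoeff _ k i
  have hm : IsMagic (coeffMatrix (ofCoeff (Q.vertexCoeff L))) := by
    rw [hc]
    exact Q.vertexCoeff_isMagic L
  refine hm.isAlgCoaction (isCoassociative_of_coeffMatrix fun k i => ?_)
  rw [hc]
  conv_lhs => rw [Q.vertexCoeff, map_sum]
  simp only [Q.comul_q]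
  rw [Finset.sum_comm, Fintype.sum_prod_type]
  refine Finset.sum_congr rfl fun k' _ => ?_
  simp only [← MinTensor.tmul_sum, Q.sum_q_eq_vertexCoeff, ← MinTensor.sum_tmul]

theorem Q.vertexCoeff_mul_q (k i : V) (s : Fin G.maxMult) (b : Idx G) :
    Q.vertexCoeff L k i * Q.q L (k, s) b = if b.1 = i then Q.q L (k, s) b else 0 := by
  obtain ⟨j, r⟩ := b
  rw [← Q.sum_q_eq_vertexCoeff L k i s, Finset.sum_mul]
  split_ifs with h
  · subst h
    rw [Finset.sum_eq_single r]
    · exact (Q.rel L).idem _ _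
    · intro r' _ hr
      exact (Q.rel L).row_orth _ _ _ (by simpa using hr)
    · simp
  · refine Finset.sum_eq_zero fun r' _ => (Q.rel L).row_orth _ _ _ ?_
    simp only [ne_eq, Prod.mk.injEq, not_and]
    exact fun hij => absurd hij.symm h

theorem Q.q_mul_vertexCoeff (k i : V) (s : Fin G.maxMult) (b : Idx G) :
    Q.q L (k, s) b * Q.vertexCoeff L k i = if b.1 = i then Q.q L (k, s) b else 0 := by
  have h := congrArg star (Q.vertexCoeff_mul_q L k i s b)
  rw [star_mul, (Q.rel L).selfAdjoint, (Q.vertexCoeff_isMagic L).selfAdjoint] at h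
  rw [h]
  split_ifs
  · exact (Q.rel L).selfAdjoint _ _
  · exact star_zero _

variable [DecidableEq E]

theorem Q.respectsBimodule :
    G.RespectsBimodule (ofCoeff (Q.vertexCoeff L)) (Q.edgeMap L) := by
  intro f ξ
  constructor <;> funext σ
  · rw [apply_eq_sum_coeffMatrix, apply_eq_sum_coeffMatrix, apply_eq_sum_coeffMatrix,
      Finset.sum_mul_sum, Finset.sum_comm]
    refine Finset.sum_congr rfl fun τ _ => ?_
    simp only [coeffMatrix_ofCoeff, Q.coeffMatrix_edgeMap, smul_mul_smul_comm, ← mul_assoc]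
    have h : ∀ i, Q.vertexCoeff L (G.source σ) i * Q.q L (L.srcIdx σ) (L.srcIdx τ) =
        if G.source τ = i then Q.q L (L.srcIdx σ) (L.srcIdx τ) else 0 := fun i =>
      Q.vertexCoeff_mul_q L _ i _ _
    simp [h]
  · rw [apply_eq_sum_coeffMatrix, apply_eq_sum_coeffMatrix, apply_eq_sum_coeffMatrix,
      Finset.sum_mul_sum]
    refine Finset.sum_congr rfl fun τ _ => ?_
    simp only [coeffMatrix_ofCoeff, Q.coeffMatrix_edgeMap, smul_mul_smul_comm, mul_assoc]
    have h : ∀ i, Q.q L (L.tgtIdx σ) (L.tgtIdx τ) * Q.vertexCoeff L (G.target σ) i =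
        if G.target τ = i then Q.q L (L.tgtIdx σ) (L.tgtIdx τ) else 0 := fun i =>
      Q.q_mul_vertexCoeff L _ i _ _
    simp [h]

theorem Q.triple_mem_catSym (hG : G.IsUniform) : Q.triple L hG ∈ G.catSym :=
  ⟨{ cqg := Q.isCQG L hG
     corep := Q.isBiunitaryCorep L hG
     vertex := ⟨_, Q.vertex_isAlgCoaction L hG, Q.respectsBimodule L⟩
     fixes_one := Q.edgeMap_one L hG }, Q.restrictedOrthogonality L⟩

end Multigraph

/-! ### Co-actions that preserve a weight -/

/-- A co-action on `C(X)` that leaves invariant a functional with non-zero weights is given by a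
quantum permutation matrix. Invariance provides a left inverse of the matrix, and by density of
`γ(C(X)) (1 ⊗ A)` this is a right inverse as well. -/
theorem IsAlgCoaction.isMagic_of_invariant {A : Type u} [CStarAlgebra A] {X : Type u} [Fintype X]
    [DecidableEq X] {Δ : A →⋆ₐ[ℂ] MinTensor A A} {γ : (X → ℂ) →ₗ[ℂ] (X → A)}
    (h : IsAlgCoaction Δ γ) {d : X → ℂ} (hd : ∀ x, d x ≠ 0)
    (hinv : ∀ i, ∑ k, d k • coeffMatrix γ k i = d i • (1 : A)) : IsMagic (coeffMatrix γ) := by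
  set p := coeffMatrix γ with hp
  have hid : ∀ x y, p x y * p x y = p x y := fun x y => by simp [hp, h.coeff_mul_coeff]
  have horth : ∀ x y z, y ≠ z → p x y * p x z = 0 := fun x y z hyz => by
    simp [hp, h.coeff_mul_coeff, hyz]
  -- The left inverse `d⁻¹ q⋆ d` is a right inverse: this is a closed condition on `z`, and it holds
  -- on the dense subspace.
  have hrinv : ∀ z : X → A,
      (fun k => ∑ i, p k i * ((d i)⁻¹ • ∑ k', d k' • (p k' i * z k'))) = z := by
    intro z
    have hz : z ∈ closure (Submodule.span ℂ
        {z : X → A | ∃ (f : X → ℂ) (a : A), z = fun x => γ f x * a} : Set (X → A)) := by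
      rw [h.dense]
      trivial
    refine closure_minimal (t := {z : X → A |
      (fun k => ∑ i, p k i * ((d i)⁻¹ • ∑ k', d k' • (p k' i * z k'))) = z}) ?_
      (isClosed_eq (by fun_prop) continuous_id) hz
    intro w hw
    induction hw using Submodule.span_induction with
    | zero => funext k; simp
    | add x y _ _ hx hy =>
      funext k
      have hx := congrFun hx k
      have hy := congrFun hy k
      simp only [Pi.add_apply, mul_add, smul_add, Finset.sum_add_distrib] at hx hy ⊢
      rw [hx, hy]
    | smul c x _ hx =>
      funext k
      have hx := congrFun hx k
      simp only [Pi.smul_apply, mul_smul_comm, smul_comm _ c, ← Finset.smul_sum] at hx ⊢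
      rw [hx]
    | mem z hz =>
      obtain ⟨f, a, rfl⟩ := hz
      funext k
      have h1 : ∀ k i, p k i * (γ f k * a) = f i • (p k i * a) := fun k i => by
        rw [apply_eq_sum_coeffMatrix, ← mul_assoc, Finset.mul_sum, Finset.sum_eq_single i]
        · rw [mul_smul_comm, hid, smul_mul_assoc]
        · intro j _ hj
          rw [mul_smul_comm, horth _ _ _ hj.symm, smul_zero]
        · simp
      have h2 : ∀ i, (d i)⁻¹ • ∑ k', d k' • (p k' i * (γ f k' * a)) = f i • a := fun i => by
        simp only [h1, smul_comm _ (f i), ← smul_mul_assoc, ← Finset.smul_sum, ← Finset.sum_mul]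
        rw [hinv, inv_smul_smul₀ (hd i), smul_one_mul]
      simp only [h2]
      simp only [apply_eq_sum_coeffMatrix γ f, Finset.sum_mul, mul_smul_comm, smul_mul_assoc, ← hp]
  -- Apply this to the basis vector at `k'`, and multiply by `p k i` to isolate one summand.
  have hker : ∀ k k' i, ((d i)⁻¹ * d k') • (p k i * p k' i) = if k = k' then p k i else 0 := by
    intro k k' i
    have h1 := congrArg (fun y => p k i * y) (congrFun (hrinv (Pi.single k' 1)) k)
    simp only [Pi.single_apply, mul_ite, mul_one, mul_zero, smul_ite, smul_zero,
      Finset.sum_ite_eq', Finset.mem_univ, if_true, Finset.mul_sum] at h1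
    rw [Finset.sum_eq_single i] at h1
    · rw [← h1, ← mul_assoc, hid, smul_smul, mul_smul_comm]
    · intro j _ hj
      rw [← mul_assoc, horth _ _ _ hj.symm, zero_mul]
    · simp
  refine .of_sum_eq_one h.star_coeff hid h.row_sum fun i => ?_
  have hdk : ∀ k, d k • p k i = d i • p k i := fun k => by
    have := hker k k i
    rw [hid, if_pos rfl] at this
    conv_rhs => rw [← this, smul_smul, mul_inv_cancel_left₀ (hd i)]
  have := hinv i
  simp only [hdk, ← Finset.smul_sum] at this
  exact smul_right_injective _ (hd i) this

/-! ### Restrictedly orthogonal co-actions on the multigraph -/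

namespace Multigraph

variable {V E : Type u} [DecidableEq V] [DecidableEq E] {G : Multigraph V E}

section Corep

variable {A : Type u} [CStarAlgebra A] {Δ : A →⋆ₐ[ℂ] MinTensor A A}
  {α : (V → ℂ) →ₗ[ℂ] (V → A)} {β : (E → ℂ) →ₗ[ℂ] (E → A)}

theorem RespectsBimodule.coeff_mul_coeff (hb : G.RespectsBimodule α β) (σ τ : E) (i : V) :
    coeffMatrix α (G.source σ) i * coeffMatrix β σ τ =
      if G.source τ = i then coeffMatrix β σ τ else 0 := by
  have h := congrFun (hb (Pi.single i 1) (Pi.single τ 1)).1 σ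
  have h' : (fun e => (Pi.single i 1 : V → ℂ) (G.source e) * (Pi.single τ 1 : E → ℂ) e) =
      if G.source τ = i then Pi.single τ 1 else 0 := by
    funext e
    by_cases he : e = τ
    · subst he; by_cases hi : G.source e = i <;> simp [hi]
    · by_cases hi : G.source τ = i <;> simp [he, hi]
  rw [h'] at h
  simp only [coeffMatrix_apply]
  rw [← h]
  split_ifs <;> simp

theorem RespectsBimodule.coeff_mul_coeff_target (hb : G.RespectsBimodule α β) (σ τ : E) (j : V) :
    coeffMatrix β σ τ * coeffMatrix α (G.target σ) j =
      if G.target τ = j then coeffMatrix β σ τ else 0 := by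
  have h := congrFun (hb (Pi.single j 1) (Pi.single τ 1)).2 σ
  have h' : (fun e => (Pi.single τ 1 : E → ℂ) e * (Pi.single j 1 : V → ℂ) (G.target e)) =
      if G.target τ = j then Pi.single τ 1 else 0 := by
    funext e
    by_cases he : e = τ
    · subst he; by_cases hi : G.target e = j <;> simp [hi]
    · by_cases hi : G.target τ = j <;> simp [he, hi]
  rw [h'] at h
  simp only [coeffMatrix_apply]
  rw [← h]
  split_ifs <;> simp

variable [Fintype E]

theorem _root_.IsBiunitaryCorep.sum_star_mul (hc : IsBiunitaryCorep Δ β) (τ τ' : E) :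
    ∑ σ, star (coeffMatrix β σ τ) * coeffMatrix β σ τ' = if τ = τ' then 1 else 0 := by
  have h := congrFun (congrFun (Unitary.mem_iff.1 hc.isUnitary).1 τ) τ'
  rwa [Matrix.mul_apply, Matrix.one_apply] at h

theorem _root_.IsBiunitaryCorep.sum_mul_star (hc : IsBiunitaryCorep Δ β) (σ : E) :
    ∑ τ, coeffMatrix β σ τ * star (coeffMatrix β σ τ) = 1 := by
  have h := congrFun (congrFun (Unitary.mem_iff.1 hc.isUnitary).2 σ) σ
  rwa [Matrix.mul_apply, Matrix.one_apply_eq] at h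

theorem _root_.IsBiunitaryCorep.conj_sum_star_mul (hc : IsBiunitaryCorep Δ β) (τ : E) :
    ∑ σ, coeffMatrix β σ τ * star (coeffMatrix β σ τ) = 1 := by
  have h := congrFun (congrFun (Unitary.mem_iff.1 hc.conj_isUnitary).1 τ) τ
  rw [Matrix.mul_apply, Matrix.one_apply_eq] at h
  simpa using h

theorem _root_.IsBiunitaryCorep.conj_sum_mul_star (hc : IsBiunitaryCorep Δ β) (σ : E) :
    ∑ τ, star (coeffMatrix β σ τ) * coeffMatrix β σ τ = 1 := by
  have h := congrFun (congrFun (Unitary.mem_iff.1 hc.conj_isUnitary).2 σ) σ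
  rw [Matrix.mul_apply, Matrix.one_apply_eq] at h
  simpa using h

theorem sum_coeff_row (h1 : β 1 = 1) (σ : E) : ∑ τ, coeffMatrix β σ τ = 1 := by
  have := congrFun h1 σ
  rw [apply_eq_sum_coeffMatrix] at this
  simpa using this

/-- Since `β` is unitary and fixes the constant function, so does its adjoint. -/
theorem _root_.IsBiunitaryCorep.sum_coeff_col (hc : IsBiunitaryCorep Δ β) (h1 : β 1 = 1) (τ : E) :
    ∑ σ, coeffMatrix β σ τ = 1 := by
  have h : ∑ σ, star (coeffMatrix β σ τ) * ∑ τ', coeffMatrix β σ τ' = 1 := by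
    simp only [Finset.mul_sum]
    rw [Finset.sum_comm]
    simp [hc.sum_star_mul]
  simp only [sum_coeff_row h1, mul_one, ← star_sum] at h
  simpa using congrArg star h

theorem RespectsBimodule.sum_coeff_source (hb : G.RespectsBimodule α β)
    (hc : IsBiunitaryCorep Δ β) (i : V) :
    ∑ σ, coeffMatrix α (G.source σ) i = ∑ τ, if G.source τ = i then 1 else 0 := by
  calc ∑ σ, coeffMatrix α (G.source σ) i
      = ∑ σ, ∑ τ, coeffMatrix α (G.source σ) i *
          (coeffMatrix β σ τ * star (coeffMatrix β σ τ)) :=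
        Finset.sum_congr rfl fun σ _ => by rw [← Finset.mul_sum, hc.sum_mul_star, mul_one]
    _ = ∑ τ, if G.source τ = i then
          ∑ σ, coeffMatrix β σ τ * star (coeffMatrix β σ τ) else 0 := by
        rw [Finset.sum_comm]
        refine Finset.sum_congr rfl fun τ _ => ?_
        simp only [← mul_assoc, hb.coeff_mul_coeff]
        split_ifs <;> simp
    _ = _ := by simp only [hc.conj_sum_star_mul]

theorem RespectsBimodule.sum_coeff_target (hb : G.RespectsBimodule α β)
    (hc : IsBiunitaryCorep Δ β) (j : V) :
    ∑ σ, coeffMatrix α (G.target σ) j = ∑ τ, if G.target τ = j then 1 else 0 := by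
  calc ∑ σ, coeffMatrix α (G.target σ) j
      = ∑ σ, ∑ τ, star (coeffMatrix β σ τ) * coeffMatrix β σ τ *
          coeffMatrix α (G.target σ) j :=
        Finset.sum_congr rfl fun σ _ => by rw [← Finset.sum_mul, hc.conj_sum_mul_star, one_mul]
    _ = ∑ τ, if G.target τ = j then
          ∑ σ, star (coeffMatrix β σ τ) * coeffMatrix β σ τ else 0 := by
        rw [Finset.sum_comm]
        refine Finset.sum_congr rfl fun τ _ => ?_
        simp only [mul_assoc, hb.coeff_mul_coeff_target]
        split_ifs <;> simp
    _ = _ := by simp only [hc.sum_star_mul, if_true]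

variable [Fintype V]

/-- The co-action on the vertices is given by a quantum permutation matrix, because it leaves the
functional invariant whose weights are the numbers of edge ends at the vertices; these are not zero,
there being no isolated vertex. -/
theorem RespectsBimodule.vertex_isMagic (hb : G.RespectsBimodule α β)
    (hc : IsBiunitaryCorep Δ β) (hα : IsAlgCoaction Δ α) : IsMagic (coeffMatrix α) := by
  let n : V → ℕ := fun k => ∑ τ, ((if G.source τ = k then 1 else 0) +
    (if G.target τ = k then 1 else 0))
  refine hα.isMagic_of_invariant (d := fun k => (n k : ℂ)) (fun k hk => ?_) fun i => ?_
  · obtain ⟨e, he⟩ := G.no_isolated k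
    simp only [n, Nat.cast_eq_zero, Finset.sum_eq_zero_iff, Finset.mem_univ, true_implies] at hk
    have := hk e
    rcases he with he | he <;> simp [he] at this
  · have h : ∀ k, (n k : ℂ) • coeffMatrix α k i = ∑ τ, ((if G.source τ = k then
        coeffMatrix α (G.source τ) i else 0) +
          (if G.target τ = k then coeffMatrix α (G.target τ) i else 0)) := fun k => by
      simp only [n, Nat.cast_sum, Finset.sum_smul]
      refine Finset.sum_congr rfl fun τ _ => ?_
      by_cases h1 : G.source τ = k <;> by_cases h2 : G.target τ = k <;>
        simp [h1, h2, two_smul]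
    simp only [h]
    rw [Finset.sum_comm]
    simp only [Finset.sum_add_distrib, Finset.sum_ite_eq, Finset.mem_univ, if_true,
      hb.sum_coeff_source hc, hb.sum_coeff_target hc, n, Nat.cast_add, Nat.cast_sum, add_smul,
      Finset.sum_smul]
    simp

/-- For an edge `τ` from `i` to `j`, the sum of `u^σ_τ` over the edges `σ` from `k` to `l` is
`q^k_i q^l_j`. -/
theorem RespectsBimodule.sum_edgesBetween (hb : G.RespectsBimodule α β)
    (hc : IsBiunitaryCorep Δ β) (hm : IsMagic (coeffMatrix α)) (h1 : β 1 = 1) (τ : E) (k l : V) :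
    ∑ σ ∈ G.edgesBetween k l, coeffMatrix β σ τ =
      coeffMatrix α k (G.source τ) * coeffMatrix α l (G.target τ) := by
  have hs : ∀ σ, coeffMatrix α k (G.source τ) * coeffMatrix β σ τ =
      if G.source σ = k then coeffMatrix β σ τ else 0 := fun σ => by
    have h := hb.coeff_mul_coeff σ τ (G.source τ)
    rw [if_pos rfl] at h
    split_ifs with hk
    · rw [← hk, h]
    · rw [← h, ← mul_assoc, hm.col_orth _ _ _ (Ne.symm hk), zero_mul]
  have ht : ∀ σ, coeffMatrix β σ τ * coeffMatrix α l (G.target τ) =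
      if G.target σ = l then coeffMatrix β σ τ else 0 := fun σ => by
    have h := hb.coeff_mul_coeff_target σ τ (G.target τ)
    rw [if_pos rfl] at h
    split_ifs with hl
    · rw [← hl, h]
    · rw [← h, mul_assoc, hm.col_orth _ _ _ hl, mul_zero]
  calc ∑ σ ∈ G.edgesBetween k l, coeffMatrix β σ τ
      = ∑ σ, coeffMatrix α k (G.source τ) * coeffMatrix β σ τ *
          coeffMatrix α l (G.target τ) := by
        rw [edgesBetween, Finset.sum_filter]
        refine Finset.sum_congr rfl fun σ _ => ?_
        rw [hs]
        by_cases hk : G.source σ = k <;> simp [hk, ht]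
    _ = _ := by rw [← Finset.sum_mul, ← Finset.mul_sum, hc.sum_coeff_col h1, mul_one]

/-- The quantum permutation matrix of the vertices defines a family with the relations of `Q` that
leaves the labels fixed. -/
theorem RespectsBimodule.qRel (hb : G.RespectsBimodule α β) (hc : IsBiunitaryCorep Δ β)
    (hm : IsMagic (coeffMatrix α)) (h1 : β 1 = 1) (L : G.EdgeLabeling) :
    QRel L fun a b : Idx G => if a.2 = b.2 then coeffMatrix α a.1 b.1 else 0 where
  selfAdjoint a b := by
    split_ifs
    · exact hm.selfAdjoint _ _
    · exact star_zero _
  idem a b := by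
    split_ifs
    · exact hm.idem _ _
    · exact mul_zero _
  row_orth a b b' hb := by
    split_ifs with h1 h2
    · exact hm.row_orth _ _ _ fun h => hb (Prod.ext h (h1.symm.trans h2))
    all_goals simp
  col_orth a a' b ha := by
    split_ifs with h1 h2
    · exact hm.col_orth _ _ _ fun h => ha (Prod.ext h (h1.trans h2.symm))
    all_goals simp
  row_sum a := by
    rw [Fintype.sum_prod_type]
    simp [hm.row_sum]
  col_sum b := by
    rw [Fintype.sum_prod_type]
    simp [hm.col_sum]
  fibre k i s s' := by simp
  edge τ k l s s' h0 := by
    have h := hb.sum_edgesBetween hc hm h1 τ k l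
    rw [h0, Finset.sum_empty] at h
    split_ifs
    · exact h.symm
    all_goals simp
  label τ k l s s' hs := by
    split_ifs with h1 h2
    · exact absurd (h1.trans h2.symm) hs
    all_goals simp

end Corep

variable [Fintype V] [Fintype E]

/-- A quantum permutation of the edges satisfies restricted orthogonality. -/
theorem catBic_subset_catSym : G.catBic ⊆ G.catSym := by
  rintro T ⟨hT, hβ⟩
  refine ⟨hT, fun σ σ' τ hσ _ _ => ?_⟩
  have hm : IsMagic (coeffMatrix T.edgeMap) := .of_sum_eq_one hβ.star_coeff
    (fun σ τ => by simp [hβ.coeff_mul_coeff]) hβ.row_sum (hT.corep.sum_coeff_col hT.fixes_one)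
  rw [hm.selfAdjoint, hm.selfAdjoint]
  exact ⟨hm.col_orth _ _ _ hσ, hm.col_orth _ _ _ hσ⟩

/-- If the co-action of `Q` is a quantum permutation of the edges, its entries
`q^{ks}_{ir} q^{ls}_{jr}` are self-adjoint. Specialized to the vertex matrix of any restrictedly
orthogonal co-action, this says that the products `q^k_i q^l_j` are projections, so that the summands
`u^σ_τ` of these are projections, too. -/
theorem catSym_subset_catBic_of_triple_mem (hG : G.IsUniform) (L : G.EdgeLabeling)
    (hQ : Q.triple L hG ∈ G.catBic) : G.catSym ⊆ G.catBic := by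
  rintro T ⟨hT, hro⟩
  refine ⟨hT, ?_⟩
  obtain ⟨α, hα, hb⟩ := hT.vertex
  have hc := hT.corep
  have h1 := hT.fixes_one
  have hm := hb.vertex_isMagic hc hα
  have hP : ∀ σ τ : E, star (coeffMatrix α (G.source σ) (G.source τ) *
      coeffMatrix α (G.target σ) (G.target τ)) = coeffMatrix α (G.source σ) (G.source τ) *
      coeffMatrix α (G.target σ) (G.target τ) := fun σ τ => by
    -- The edge `σ` may be replaced by the parallel edge that has the same label as `τ`.
    obtain ⟨σ', hs, ht, hl⟩ := L.exists_edge hG (i := G.source σ) (j := G.target σ)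
      ⟨σ, by simp [edgesBetween]⟩ (L.label τ)
    have hsa : star (coeffMatrix (Q.edgeMap L) σ' τ) = coeffMatrix (Q.edgeMap L) σ' τ :=
      hQ.2.star_coeff σ' τ
    have h := congrArg (Q.lift L (hb.qRel hc hm h1 L)) hsa
    rw [map_star, Q.coeffMatrix_edgeMap, map_mul, Q.lift_q, Q.lift_q] at h
    simpa only [EdgeLabeling.srcIdx, EdgeLabeling.tgtIdx, hs, ht, hl, if_true] using h
  have hproj : ∀ σ τ, star (coeffMatrix T.edgeMap σ τ) = coeffMatrix T.edgeMap σ τ ∧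
      coeffMatrix T.edgeMap σ τ * coeffMatrix T.edgeMap σ τ = coeffMatrix T.edgeMap σ τ := by
    intro σ τ
    have hcomm := hP σ τ
    rw [star_mul, hm.selfAdjoint, hm.selfAdjoint] at hcomm
    have hmem : ∀ ρ ∈ G.edgesBetween (G.source σ) (G.target σ),
        G.source ρ = G.source σ ∧ G.target ρ = G.target σ := fun ρ hρ => by
      simpa [edgesBetween] using hρ
    refine isProjection_of_sum_eq_projection (hP σ τ) ?_
      (hb.sum_edgesBetween hc hm h1 τ (G.source σ) (G.target σ))
      (fun ρ hρ ρ' hρ' hne => (hro ρ ρ' τ hne ((hmem ρ hρ).1.trans (hmem ρ' hρ').1.symm)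
        ((hmem ρ hρ).2.trans (hmem ρ' hρ').2.symm)).1)
      (fun ρ hρ ρ' hρ' hne => (hro ρ ρ' τ hne ((hmem ρ hρ).1.trans (hmem ρ' hρ').1.symm)
        ((hmem ρ hρ).2.trans (hmem ρ' hρ').2.symm)).2) (by simp [edgesBetween])
    rw [mul_assoc, ← mul_assoc (coeffMatrix α (G.target σ) _), hcomm, mul_assoc, hm.idem,
      ← mul_assoc, hm.idem]
  exact (IsMagic.of_sum_eq_one (fun σ τ => (hproj σ τ).1) (fun σ τ => (hproj σ τ).2)
    (sum_coeff_row h1) (hc.sum_coeff_col h1)).isAlgCoaction hc.coassoc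

end Multigraph

end

theorem mainTheorem4 {V E : Type u} [Fintype V] [DecidableEq V] [Fintype E] [DecidableEq E]
    (G : Multigraph V E) (hG : G.IsUniform) (L : G.EdgeLabeling) :
    Multigraph.Q.triple L hG ∈ G.catSym ∧
      (G.catBic ≠ G.catSym → Multigraph.Q.triple L hG ∉ G.catBic) :=
  ⟨Multigraph.Q.triple_mem_catSym L hG, fun hne hQ => hne
    (Multigraph.catBic_subset_catSym.antisymm
      (Multigraph.catSym_subset_catBic_of_triple_mem hG L hQ))⟩
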